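/- Let $(M,g)$ be a smooth pseudo-Riemannian manifold (of any dimension and signature), $\nabla$ its Levi-Civita connection, $R(X,Y)Z=\nabla_X\nabla_YZ-\nabla_Y\nabla_XZ-\nabla_{[X,Y]}Z$ its curvature tensor and $R(X,Y,Z,W)=g(R(X,Y)Z,W)$. In the coordinates $(x^i,y^i)$ of $TM$ induced by coordinates $(x^i)$ of $M$, the vertical and horizontal lifts of a vector field $X$ on $M$ are the vector fields on $TM$ with components $X^V=(0,X^k)$ and $X^H=(X^k,-y^i\Gamma^k_{ij}X^j)$, where $\Gamma^k_{ij}$ are the Christoffel symbols of $g$. The Sasaki metric $\hat g$ on $TM$ is defined by $$\hat g(X^H,Y^H)=\hat g(X^V,Y^V)=g(X,Y),\qquad \hat g(X^H,Y^V)=0 .$$ Then $\hat g$ is a smooth pseudo-Riemannian metric on $TM$, and its curvature tensor $\hat R$ (type $(0,4)$, formed from the Levi-Civita connection of $\hat g$ with the same conventions) satisfies, for all vector fields $X,Y,Z,W$ on $M$, at every point $u\in T_pM$ of $TM$, \begin{align*} \hat R(X^H,Y^H,Z^H,W^H)&=R(X,Y,Z,W)+\tfrac14\{g(R(W,X)u,R(Y,Z)u)-g(R(W,Y)u,R(X,Z)u)\}+\tfrac12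 g(R(X,Y)u,R(Z,W)u),\\ \hat R(X^H,Y^H,Z^H,W^V)&=-\tfrac12 g\big((\nabla_XR)(Y,Z)u-(\nabla_YR)(X,Z)u,\,W\big),\\ \hat R(X^H,Y^H,Z^V,W^V)&=R(X,Y,Z,W)-\tfrac14\{g(R(u,W)X,R(u,Z)Y)-g(R(u,W)Y,R(u,Z)X)\},\\ \hat R(X^H,Y^V,Z^H,W^H)&=\tfrac12 g\big((\nabla_XR)(u,Y)Z,\,W\big),\\ \hat R(X^H,Y^V,Z^H,W^V)&=\tfrac12R(X,Z,Y,W)-\tfrac14 g(R(u,Y)Z,R(u,W)X),\\ \hat R(X^V,Y^V,Z^H,W^H)&=R(X,Y,Z,W)-\tfrac14\{g(R(u,Y)Z,R(u,X)W)-g(R(u,X)Z,R(u,Y)W)\},\\ \hat R(X^V,Y^V,Z^H,W^V)&=\hat R(X^H,Y^V,Z^V,W^V)=\hat R(X^V,Y^V,Z^V,W^V)=0, \end{align*} where the right-hand sides are evaluated at $p$. -/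

import Mathlib

open scoped Manifold ContDiff

namespace SasakiMetric

noncomputable section

/-! ### Calculus of a metric on an open piece of a vector space

`G y` is the bilinear form of a (pseudo-Riemannian) metric at the point `y` of `V`. -/

section Local

variable {V : Type*} [NormedAddCommGroup V] [NormedSpace ℝ V]

/-- Christoffel symbols of the first kind:
`Γ(a, b, w) = (1/2) (∂_a G(b, w) + ∂_b G(a, w) - ∂_w G(a, b))`. -/
def christoffelFirst (G : V → V →L[ℝ] V →L[ℝ] ℝ) (y a : V) : V →L[ℝ] V →L[ℝ] ℝ :=
  (1 / 2 : ℝ) • (fderiv ℝ G y a + (fderiv ℝ G y).flip a - ((fderiv ℝ G y).flip a).flip)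

theorem christoffelFirst_apply (G : V → V →L[ℝ] V →L[ℝ] ℝ) (y a b w : V) :
    christoffelFirst G y a b w =
      (1 / 2 : ℝ) * (fderiv ℝ G y a b w + fderiv ℝ G y b a w - fderiv ℝ G y w a b) := by
  simp [christoffelFirst]

/-- Christoffel symbols (of the second kind): `Γ(a, b)` is the vector with
`G(Γ(a, b), w) = Γ(a, b, w)` for all `w`, i.e. the index is raised with the inverse of
`G y : V → V*`. -/
def christoffel (G : V → V →L[ℝ] V →L[ℝ] ℝ) (y a : V) : V →L[ℝ] V :=
  (G y).inverse ∘L christoffelFirst G y a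

theorem christoffel_spec (G : V → V →L[ℝ] V →L[ℝ] ℝ) (y a b w : V)
    (h : (G y).IsInvertible) :
    G y (christoffel G y a b) w = christoffelFirst G y a b w := by
  obtain ⟨e, he⟩ := h
  simp [christoffel, ← he]

/-- The Levi-Civita covariant derivative `∇_X Y = ∂_X Y + Γ(X, Y)` of vector fields. -/
def nablaLocal (G : V → V →L[ℝ] V →L[ℝ] ℝ) (X Y : V → V) (y : V) : V :=
  fderiv ℝ Y y (X y) + christoffel G y (X y) (Y y)

/-- The curvature operator `R(X, Y) Z = ∇_X ∇_Y Z - ∇_Y ∇_X Z - ∇_{[X, Y]} Z` on vector fields. -/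
def curvatureOperator (G : V → V →L[ℝ] V →L[ℝ] ℝ) (X Y Z : V → V) (y : V) : V :=
  nablaLocal G X (nablaLocal G Y Z) y - nablaLocal G Y (nablaLocal G X Z) y -
    nablaLocal G (VectorField.lieBracket ℝ X Y) Z y

/-- The curvature tensor at `y` on vectors `a, b, c`, obtained by extending them to vector fields
with constant components. -/
def curvatureLocal (G : V → V →L[ℝ] V →L[ℝ] ℝ) (y a b c : V) : V :=
  curvatureOperator G (fun _ ↦ a) (fun _ ↦ b) (fun _ ↦ c) y

/-- The covariant derivative of the curvature tensor,
`(∇_e R)(a, b) c = ∇_e (R(a, b) c) - R(∇_e a, b) c - R(a, ∇_e b) c - R(a, b) ∇_e c`,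
where `e, a, b, c` are extended to vector fields with constant components. -/
def nablaCurvatureLocal (G : V → V →L[ℝ] V →L[ℝ] ℝ) (y e a b c : V) : V :=
  nablaLocal G (fun _ ↦ e) (fun z ↦ curvatureLocal G z a b c) y
    - curvatureLocal G y (nablaLocal G (fun _ ↦ e) (fun _ ↦ a) y) b c
    - curvatureLocal G y a (nablaLocal G (fun _ ↦ e) (fun _ ↦ b) y) c
    - curvatureLocal G y a b (nablaLocal G (fun _ ↦ e) (fun _ ↦ c) y)

end Local

/-! ### Pseudo-Riemannian manifolds -/

section Manifold

variable {E : Type*} [NormedAddCommGroup E] [NormedSpace ℝ E]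
  {H : Type*} [TopologicalSpace H] (I : ModelWithCorners ℝ E H)
  {M : Type*} [TopologicalSpace M] [ChartedSpace H M]

/-- Fields of bilinear forms on the tangent spaces of a manifold. -/
abbrev BilinField (M : Type*) [TopologicalSpace M] [ChartedSpace H M] :=
  ∀ p : M, TangentSpace I p →L[ℝ] TangentSpace I p →L[ℝ] ℝ

/-- Pull-back of a bilinear form under a linear map, `(a, b) ↦ B (A a) (A b)`. -/
def pullbackForm {V W : Type*}
    [AddCommGroup V] [Module ℝ V] [TopologicalSpace V] [IsTopologicalAddGroup V]
    [ContinuousSMul ℝ V]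
    [AddCommGroup W] [Module ℝ W] [TopologicalSpace W] [IsTopologicalAddGroup W]
    [ContinuousSMul ℝ W]
    (B : W →L[ℝ] W →L[ℝ] ℝ) (A : V →L[ℝ] W) : V →L[ℝ] V →L[ℝ] ℝ :=
  ContinuousLinearMap.precomp ℝ A ∘L B ∘L A

@[simp] theorem pullbackForm_apply {V W : Type*}
    [AddCommGroup V] [Module ℝ V] [TopologicalSpace V] [IsTopologicalAddGroup V]
    [ContinuousSMul ℝ V]
    [AddCommGroup W] [Module ℝ W] [TopologicalSpace W] [IsTopologicalAddGroup W]
    [ContinuousSMul ℝ W]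
    (B : W →L[ℝ] W →L[ℝ] ℝ) (A : V →L[ℝ] W) (a b : V) :
    pullbackForm B A a b = B (A a) (A b) := rfl

/-- A pseudo-Riemannian metric: a smooth field of symmetric nondegenerate bilinear forms (of any
signature) on the tangent spaces. -/
structure IsPseudoRiemannian [IsManifold I 1 M] (g : BilinField I M) : Prop where
  symm : ∀ (p : M) (v w : TangentSpace I p), g p v w = g p w v
  nondegenerate : ∀ (p : M) (v : TangentSpace I p), (∀ w, g p v w = 0) → v = 0
  contMDiff : ContMDiff I (I.prod 𝓘(ℝ, E →L[ℝ] E →L[ℝ] ℝ)) ∞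
    (fun p ↦ Bundle.TotalSpace.mk' (E →L[ℝ] E →L[ℝ] ℝ)
      (E := fun p : M ↦ TangentSpace I p →L[ℝ] TangentSpace I p →L[ℝ] ℝ) p (g p))

/-- The components of a tangent vector at `p` with respect to the chart around `p`. -/
def components (p : M) : TangentSpace I p →L[ℝ] E :=
  mfderiv I 𝓘(ℝ, E) (extChartAt I p) p

/-- The tangent vector at `p` with given components with respect to the chart around `p`. -/
def ofComponents (p : M) : E →L[ℝ] TangentSpace I p :=
  (mfderiv I 𝓘(ℝ, E) (extChartAt I p) p).inverse

variable {I}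

/-- The metric in the coordinates of the chart around `p`, i.e. the pull-back of `g` under the
inverse of this chart (meaningful on the target of the chart). -/
def metricInChart (g : BilinField I M) (p : M) (y : E) : E →L[ℝ] E →L[ℝ] ℝ :=
  pullbackForm (V := E) (g ((extChartAt I p).symm y))
    (mfderivWithin 𝓘(ℝ, E) I (extChartAt I p).symm (Set.range I) y)

/-- The Christoffel symbols `Γ` of `g` at `p` in the chart around `p`. -/
def christoffelAt (g : BilinField I M) (p : M) (a : E) : E →L[ℝ] E :=
  christoffel (metricInChart g p) (extChartAt I p p) a

/-- The curvature tensor `R(x, y) z` of (the Levi-Civita connection of) `g` at `p`, of type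
`(1, 3)`. -/
def curvature (g : BilinField I M) (p : M) (x y z : TangentSpace I p) : TangentSpace I p :=
  ofComponents I p (curvatureLocal (metricInChart g p) (extChartAt I p p)
    (components I p x) (components I p y) (components I p z))

/-- The curvature tensor `R(x, y, z, w) = g(R(x, y) z, w)` of type `(0, 4)`. -/
def curvature4 (g : BilinField I M) (p : M) (x y z w : TangentSpace I p) : ℝ :=
  g p (curvature g p x y z) w

/-- The covariant derivative `(∇_e R)(x, y) z` of the curvature tensor of `g` at `p`. -/
def nablaCurvature (g : BilinField I M) (p : M) (e x y z : TangentSpace I p) : TangentSpace I p :=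
  ofComponents I p (nablaCurvatureLocal (metricInChart g p) (extChartAt I p p)
    (components I p e) (components I p x) (components I p y) (components I p z))

/-! ### Lifts to the tangent bundle and the Sasaki metric

The chart of the tangent bundle around `u ∈ T_p M` is the one induced by the chart of `M` around
`p`; so a tangent vector of the tangent bundle at `u` has components in `E × E`. -/

variable [IsManifold I ∞ M]

/-- The vertical lift `X^V`, with components `(0, X)` in the induced coordinates. -/
def verticalLift (X : ∀ p : M, TangentSpace I p) (u : TangentBundle I M) :
    TangentSpace I.tangent u :=
  ofComponents I.tangent u ((0, components I u.proj (X u.proj)) : E × E)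

/-- The horizontal lift `X^H`, with components `(X, -Γ(u, X))` in the induced coordinates. -/
def horizontalLift (g : BilinField I M) (X : ∀ p : M, TangentSpace I p) (u : TangentBundle I M) :
    TangentSpace I.tangent u :=
  ofComponents I.tangent u ((components I u.proj (X u.proj),
    -christoffelAt g u.proj (components I u.proj u.snd) (components I u.proj (X u.proj))) : E × E)

/-- The horizontal part of a tangent vector of the tangent bundle: the differential of the bundle
projection; it maps `X^H` to `X` and `X^V` to `0`. -/
def horizontalPart (u : TangentBundle I M) :
    TangentSpace I.tangent u →L[ℝ] TangentSpace I u.proj :=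
  mfderiv I.tangent I (fun v : TangentBundle I M ↦ v.proj) u

/-- The vertical part of a tangent vector of the tangent bundle (the connection map): a vector
with components `(a, b)` goes to the vector with components `b + Γ(u, a)`; it maps `X^H` to `0`
and `X^V` to `X`. -/
def verticalPart (g : BilinField I M) (u : TangentBundle I M) :
    TangentSpace I.tangent u →L[ℝ] TangentSpace I u.proj :=
  ofComponents I u.proj ∘L
    (ContinuousLinearMap.snd ℝ E E +
      christoffelAt g u.proj (components I u.proj u.snd) ∘L ContinuousLinearMap.fst ℝ E E) ∘L
    components I.tangent u

/-- The Sasaki metric (diagonal lift of `g`) on the tangent bundle. -/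
def sasaki (g : BilinField I M) : BilinField I.tangent (TangentBundle I M) := fun u ↦
  pullbackForm (g u.proj) (horizontalPart u) + pullbackForm (g u.proj) (verticalPart g u)

@[simp] theorem components_ofComponents (p : M) (a : E) :
    components I p (ofComponents I p a) = a := by
  simp only [components, ofComponents, mfderiv_extChartAt_self]
  erw [ContinuousLinearMap.inverse_id]
  rfl

@[simp] theorem ofComponents_components (p : M) (v : TangentSpace I p) :
    ofComponents I p (components I p v) = v := by
  simp only [components, ofComponents, mfderiv_extChartAt_self]
  erw [ContinuousLinearMap.inverse_id]
  rfl

theorem horizontalPart_apply (u : TangentBundle I M) (ξ : TangentSpace I.tangent u) :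
    components I u.proj (horizontalPart u ξ) = (show E × E from components I.tangent u ξ).1 := by
  have hu : u ∈ (chartAt (ModelProd H E) u).source := mem_chart_source _ u
  have h1 : HasMFDerivAt I.tangent I (fun v : TangentBundle I M ↦ v.proj) u (horizontalPart u) := by
    refine MDifferentiableAt.hasMFDerivAt ?_
    exact (Bundle.contMDiff_proj (n := 1) (TangentSpace I)).mdifferentiable one_ne_zero u
  have h2 : HasMFDerivAt I 𝓘(ℝ, E) (extChartAt I u.proj) u.proj (components I u.proj) :=
    (mdifferentiableAt_extChartAt (mem_chart_source H u.proj)).hasMFDerivAt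
  have h3 : HasMFDerivAt I.tangent 𝓘(ℝ, E × E) (extChartAt I.tangent u) u
      (components I.tangent u) :=
    (mdifferentiableAt_extChartAt hu).hasMFDerivAt
  have h4 := h2.comp u h1
  have h5 : HasMFDerivAt 𝓘(ℝ, E × E) 𝓘(ℝ, E) (Prod.fst : E × E → E) (extChartAt I.tangent u u)
      (ContinuousLinearMap.fst ℝ E E) :=
    (hasFDerivAt_fst).hasMFDerivAt
  have h6 := h5.comp u h3
  have h7 : (Prod.fst : E × E → E) ∘ (extChartAt I.tangent u) =
      (extChartAt I u.proj) ∘ (fun v : TangentBundle I M ↦ v.proj) := by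
    rfl
  rw [h7] at h6
  exact congrArg (fun L ↦ L ξ) (hasMFDerivAt_unique h4 h6)

theorem horizontalPart_horizontalLift (g : BilinField I M) (X : ∀ p : M, TangentSpace I p)
    (u : TangentBundle I M) : horizontalPart u (horizontalLift g X u) = X u.proj := by
  rw [← ofComponents_components u.proj (horizontalPart u _), horizontalPart_apply]
  simp [horizontalLift]

theorem horizontalPart_verticalLift (X : ∀ p : M, TangentSpace I p)
    (u : TangentBundle I M) : horizontalPart u (verticalLift X u) = 0 := by
  rw [← ofComponents_components u.proj (horizontalPart u _), horizontalPart_apply]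
  simp [verticalLift]

theorem verticalPart_horizontalLift (g : BilinField I M) (X : ∀ p : M, TangentSpace I p)
    (u : TangentBundle I M) : verticalPart g u (horizontalLift g X u) = 0 := by
  simp [horizontalLift, verticalPart]

theorem verticalPart_verticalLift (g : BilinField I M) (X : ∀ p : M, TangentSpace I p)
    (u : TangentBundle I M) : verticalPart g u (verticalLift X u) = X u.proj := by
  simp [verticalLift, verticalPart]

theorem sasaki_horizontal_horizontal (g : BilinField I M) (X Y : ∀ p : M, TangentSpace I p)
    (u : TangentBundle I M) :
    sasaki g u (horizontalLift g X u) (horizontalLift g Y u) = g u.proj (X u.proj) (Y u.proj) := by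
  simp [sasaki, horizontalPart_horizontalLift, verticalPart_horizontalLift]

theorem sasaki_vertical_vertical (g : BilinField I M) (X Y : ∀ p : M, TangentSpace I p)
    (u : TangentBundle I M) :
    sasaki g u (verticalLift X u) (verticalLift Y u) = g u.proj (X u.proj) (Y u.proj) := by
  simp [sasaki, horizontalPart_verticalLift, verticalPart_verticalLift]

theorem sasaki_horizontal_vertical (g : BilinField I M) (X Y : ∀ p : M, TangentSpace I p)
    (u : TangentBundle I M) :
    sasaki g u (horizontalLift g X u) (verticalLift Y u) = 0 := by
  simp [sasaki, horizontalPart_horizontalLift, verticalPart_horizontalLift,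
    horizontalPart_verticalLift, verticalPart_verticalLift]

end Manifold

end

end SasakiMetric

/-! The map `splitting`, ξ ↦ (ξ₁, ξ₂ + Γ(u, ξ₁)), is a moving frame on the tangent bundle. In it the
Sasaki metric is the orthogonal sum G ⊕ G, and X^H, X^V have components (X, 0), (0, X). The whole
computation is done in this frame.

The Levi-Civita connection of ĝ is given by ∇_{X^H}Y^H = (∇_X Y)^H - ½(R(X,Y)u)^V, ∇_{X^H}Y^V = (∇_X
Y)^V + ½(R(u,Y)X)^H, ∇_{X^V}Y^H = ½(R(u,X)Y)^H and ∇_{X^V}Y^V = 0. This is the content of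
`sasakiConnection`. It is not derived from the Koszul formula:
`IsMetricOn.splitting_christoffelBilin` checks that it is torsion-free and compatible with ĝ, and
uniqueness (`IsMetricOn.christoffelBilin_eq`) does the rest. The coefficient -½ balances the
vertical part of [X^H, Y^H], which is a curvature term; the coefficients +½ are then the metric
adjoints, by the pair symmetry of R.

Cartan's structure equation in a moving frame (`frame_curvatureTrilin`) yields the curvature of ĝ
from the derivative of this connection form, and the symmetries of R bring the result to the
required shape.

Globally, ĝ is defined at each point through the chart centred at its base point.
`metricInChart_sasaki` shows that a single chart suffices nearby: the second-derivative term in the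
transformation law of Γ is the one that appears when tangent vectors of the tangent bundle change
coordinates. Smoothness and curvature of ĝ thus reduce to the coordinate computation. -/

namespace SasakiMetric

noncomputable section

open scoped Topology

set_option maxSynthPendingDepth 3

/-! ### Connections on open subsets of a vector space -/

section Connection

variable {V : Type*} [NormedAddCommGroup V] [NormedSpace ℝ V]

/-- The curvature of a connection with Christoffel symbols `Γ`, as a trilinear map. -/
def curvatureTrilin (Γ : V → V →L[ℝ] V →L[ℝ] V) (y : V) : V →L[ℝ] V →L[ℝ] V →L[ℝ] V :=
  fderiv ℝ Γ y - (fderiv ℝ Γ y).flip +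
    ((ContinuousLinearMap.compL ℝ V V V).bilinearComp (Γ y) (Γ y) -
      ((ContinuousLinearMap.compL ℝ V V V).bilinearComp (Γ y) (Γ y)).flip)

theorem curvatureTrilin_apply (Γ : V → V →L[ℝ] V →L[ℝ] V) (y a b c : V) :
    curvatureTrilin Γ y a b c = fderiv ℝ Γ y a b c - fderiv ℝ Γ y b a c +
      (Γ y a (Γ y b c) - Γ y b (Γ y a c)) := by
  simp [curvatureTrilin]

theorem contDiffOn_curvatureTrilin {Γ : V → V →L[ℝ] V →L[ℝ] V} {U : Set V} (hU : IsOpen U)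
    (hΓ : ContDiffOn ℝ ∞ Γ U) : ContDiffOn ℝ ∞ (curvatureTrilin Γ) U := by
  have h1 : ContDiffOn ℝ ∞ (fderiv ℝ Γ) U := hΓ.fderiv_of_isOpen hU (by simp)
  have h2 : ContDiffOn ℝ ∞
      (fun y ↦ (ContinuousLinearMap.compL ℝ V V V).bilinearComp (Γ y) (Γ y)) U := by
    have h3 : ContDiffOn ℝ ∞ (fun y ↦ (ContinuousLinearMap.compL ℝ V V V ∘L Γ y).flip) U :=
      ((ContinuousLinearMap.flipₗᵢ ℝ V (V →L[ℝ] V) (V →L[ℝ] V)).contDiff).comp_contDiffOn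
        (contDiffOn_const.clm_comp hΓ)
    exact ((ContinuousLinearMap.flipₗᵢ ℝ V V (V →L[ℝ] V)).contDiff).comp_contDiffOn
      (h3.clm_comp hΓ)
  have hf (f : V → V →L[ℝ] V →L[ℝ] V →L[ℝ] V) (h : ContDiffOn ℝ ∞ f U) :
      ContDiffOn ℝ ∞ (fun y ↦ (f y).flip) U :=
    ((ContinuousLinearMap.flipₗᵢ ℝ V V (V →L[ℝ] V)).contDiff).comp_contDiffOn h
  exact (h1.sub (hf _ h1)).add (h2.sub (hf _ h2))

theorem curvatureTrilin_swap (Γ : V → V →L[ℝ] V →L[ℝ] V) (y a b c : V) :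
    curvatureTrilin Γ y b a c = -curvatureTrilin Γ y a b c := by
  simp only [curvatureTrilin_apply]; abel

end Connection

/-! ### Metrics on open subsets of a vector space -/

section Metric

variable {V : Type*} [NormedAddCommGroup V] [NormedSpace ℝ V]

/-- `G` is a smooth pseudo-Riemannian metric on the open set `U`. -/
structure IsMetricOn (G : V → V →L[ℝ] V →L[ℝ] ℝ) (U : Set V) : Prop where
  isOpen : IsOpen U
  contDiffOn : ContDiffOn ℝ ∞ G U
  symm : ∀ y ∈ U, ∀ a b, G y a b = G y b a
  isInvertible : ∀ y ∈ U, (G y).IsInvertible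

/-- The Christoffel symbols of the first kind as a trilinear form. -/
def christoffelFirstTrilin (G : V → V →L[ℝ] V →L[ℝ] ℝ) (y : V) : V →L[ℝ] V →L[ℝ] V →L[ℝ] ℝ :=
  (1 / 2 : ℝ) • (fderiv ℝ G y + (fderiv ℝ G y).flip -
    (ContinuousLinearMap.flipₗᵢ ℝ V V ℝ : (V →L[ℝ] V →L[ℝ] ℝ) →L[ℝ] (V →L[ℝ] V →L[ℝ] ℝ)) ∘L
      (fderiv ℝ G y).flip)

theorem christoffelFirstTrilin_apply (G : V → V →L[ℝ] V →L[ℝ] ℝ) (y a : V) :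
    christoffelFirstTrilin G y a = christoffelFirst G y a := by
  ext b c
  simp [christoffelFirstTrilin, christoffelFirst]

/-- The Christoffel symbols of a metric as a bilinear map. -/
def christoffelBilin (G : V → V →L[ℝ] V →L[ℝ] ℝ) (y : V) : V →L[ℝ] V →L[ℝ] V :=
  ContinuousLinearMap.compL ℝ V (V →L[ℝ] ℝ) V (G y).inverse ∘L christoffelFirstTrilin G y

theorem christoffelBilin_apply (G : V → V →L[ℝ] V →L[ℝ] ℝ) (y a : V) :
    christoffelBilin G y a = christoffel G y a := by
  simp [christoffelBilin, christoffel, christoffelFirstTrilin_apply]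

variable {G : V → V →L[ℝ] V →L[ℝ] ℝ} {U : Set V}

theorem IsMetricOn.contDiffOn_christoffelFirstTrilin (hG : IsMetricOn G U) :
    ContDiffOn ℝ ∞ (christoffelFirstTrilin G) U := by
  have h1 : ContDiffOn ℝ ∞ (fderiv ℝ G) U := hG.contDiffOn.fderiv_of_isOpen hG.isOpen (by simp)
  have h2 : ContDiffOn ℝ ∞ (fun y ↦ (fderiv ℝ G y).flip) U :=
    ((ContinuousLinearMap.flipₗᵢ ℝ V V (V →L[ℝ] ℝ)).contDiff).comp_contDiffOn h1
  exact ((h1.add h2).sub (contDiffOn_const.clm_comp h2)).const_smul (1 / 2 : ℝ)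

theorem IsMetricOn.contDiffOn_christoffelBilin [CompleteSpace V] (hG : IsMetricOn G U) :
    ContDiffOn ℝ ∞ (christoffelBilin G) U := by
  have h1 : ContDiffOn ℝ ∞ (fun y ↦ (G y).inverse) U := fun y hy ↦
    ((hG.isInvertible y hy).contDiffAt_map_inverse.comp_contDiffWithinAt y (hG.contDiffOn y hy))
  exact (((ContinuousLinearMap.compL ℝ V (V →L[ℝ] ℝ) V).contDiff).comp_contDiffOn h1).clm_comp
    hG.contDiffOn_christoffelFirstTrilin

theorem IsMetricOn.differentiableAt (hG : IsMetricOn G U) {y : V} (hy : y ∈ U) :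
    DifferentiableAt ℝ G y :=
  (hG.contDiffOn.contDiffAt (hG.isOpen.mem_nhds hy)).differentiableAt (by simp)

theorem IsMetricOn.differentiableAt_christoffelBilin [CompleteSpace V] (hG : IsMetricOn G U)
    {y : V} (hy : y ∈ U) : DifferentiableAt ℝ (christoffelBilin G) y :=
  (hG.contDiffOn_christoffelBilin.contDiffAt (hG.isOpen.mem_nhds hy)).differentiableAt (by simp)

theorem IsMetricOn.eq_of_forall_apply_eq (hG : IsMetricOn G U) {y : V} (hy : y ∈ U) {a b : V}
    (h : ∀ w, G y a w = G y b w) : a = b := by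
  obtain ⟨e, he⟩ := hG.isInvertible y hy
  apply e.injective
  have : G y a = G y b := ContinuousLinearMap.ext h
  rwa [← he] at this

theorem fderiv_apply_apply {W₁ W₂ X : Type*} [NormedAddCommGroup W₁] [NormedSpace ℝ W₁]
    [NormedAddCommGroup W₂] [NormedSpace ℝ W₂] [NormedAddCommGroup X] [NormedSpace ℝ X]
    {B : V → W₁ →L[ℝ] W₂ →L[ℝ] X} {y : V}
    (hB : DifferentiableAt ℝ B y) (a : W₁) (b : W₂) (e : V) :
    fderiv ℝ (fun z ↦ B z a b) y e = fderiv ℝ B y e a b := by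
  rw [fderiv_clm_apply (hB.clm_apply (differentiableAt_const a)) (differentiableAt_const b),
    fderiv_clm_apply hB (differentiableAt_const a)]
  simp

theorem fderiv_clm_apply_apply {W₁ W₂ X : Type*} [NormedAddCommGroup W₁] [NormedSpace ℝ W₁]
    [NormedAddCommGroup W₂] [NormedSpace ℝ W₂] [NormedAddCommGroup X] [NormedSpace ℝ X]
    {B : V → W₁ →L[ℝ] W₂ →L[ℝ] X} {f : V → W₁} {g : V → W₂} {y : V}
    (hB : DifferentiableAt ℝ B y) (hf : DifferentiableAt ℝ f y) (hg : DifferentiableAt ℝ g y)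
    (e : V) :
    fderiv ℝ (fun z ↦ B z (f z) (g z)) y e =
      fderiv ℝ B y e (f y) (g y) + B y (fderiv ℝ f y e) (g y) + B y (f y) (fderiv ℝ g y e) := by
  rw [fderiv_clm_apply (hB.clm_apply hf) hg, fderiv_clm_apply hB hf]
  simp; abel

theorem IsMetricOn.fderiv_symm (hG : IsMetricOn G U) {y : V} (hy : y ∈ U) (e a b : V) :
    fderiv ℝ G y e a b = fderiv ℝ G y e b a := by
  rw [← fderiv_apply_apply (hG.differentiableAt hy), ← fderiv_apply_apply (hG.differentiableAt hy)]
  have : (fun z ↦ G z a b) =ᶠ[𝓝 y] fun z ↦ G z b a := by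
    filter_upwards [hG.isOpen.mem_nhds hy] with z hz using hG.symm z hz a b
  rw [this.fderiv_eq]

theorem IsMetricOn.apply_christoffelBilin (hG : IsMetricOn G U) {y : V} (hy : y ∈ U) (a b w : V) :
    G y (christoffelBilin G y a b) w =
      (1 / 2 : ℝ) * (fderiv ℝ G y a b w + fderiv ℝ G y b a w - fderiv ℝ G y w a b) := by
  rw [christoffelBilin_apply, christoffel_spec _ _ _ _ _ (hG.isInvertible y hy),
    christoffelFirst_apply]

theorem IsMetricOn.christoffelBilin_symm (hG : IsMetricOn G U) {y : V} (hy : y ∈ U) (a b : V) :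
    christoffelBilin G y a b = christoffelBilin G y b a := by
  refine hG.eq_of_forall_apply_eq hy fun w ↦ ?_
  rw [hG.apply_christoffelBilin hy, hG.apply_christoffelBilin hy, hG.fderiv_symm hy w a b]
  ring

/-- Metric compatibility ∇G = 0, in coordinates. -/
theorem IsMetricOn.fderiv_eq (hG : IsMetricOn G U) {y : V} (hy : y ∈ U) (a b c : V) :
    fderiv ℝ G y a b c =
      G y (christoffelBilin G y a b) c + G y b (christoffelBilin G y a c) := by
  rw [hG.symm y hy b, hG.apply_christoffelBilin hy, hG.apply_christoffelBilin hy,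
    hG.fderiv_symm hy a c b, hG.fderiv_symm hy b, hG.fderiv_symm hy c]
  ring

/-- The Levi-Civita connection is the only torsion-free connection compatible with the metric. -/
theorem IsMetricOn.christoffelBilin_eq (hG : IsMetricOn G U) {y : V} (hy : y ∈ U)
    (Γ : V → V → V) (hsymm : ∀ a b, Γ a b = Γ b a)
    (h : ∀ a b c, fderiv ℝ G y a b c = G y (Γ a b) c + G y b (Γ a c)) (a b : V) :
    christoffelBilin G y a b = Γ a b := by
  refine hG.eq_of_forall_apply_eq hy fun w ↦ ?_
  rw [hG.apply_christoffelBilin hy, h, h, h, hsymm b a, hsymm w a, hsymm w b,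
    hG.symm y hy b, hG.symm y hy a]
  ring

/-- Constant fields commute, so the bracket term vanishes. The trilinear form of the curvature can
be differentiated as a map into a normed space. -/
theorem IsMetricOn.curvatureLocal_eq [CompleteSpace V] (hG : IsMetricOn G U) {y : V} (hy : y ∈ U)
    (a b c : V) : curvatureLocal G y a b c = curvatureTrilin (christoffelBilin G) y a b c := by
  have hd := hG.differentiableAt_christoffelBilin hy
  have hn (a b : V) : nablaLocal G (fun _ ↦ a) (fun _ ↦ b) = fun z ↦ christoffelBilin G z a b := by
    ext z; simp [nablaLocal, christoffelBilin_apply]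
  have hbr : VectorField.lieBracket ℝ (fun _ : V ↦ a) (fun _ ↦ b) = 0 := by
    ext z; simp [VectorField.lieBracket]
  rw [curvatureLocal, curvatureOperator, hn, hn, hbr, curvatureTrilin_apply]
  simp only [nablaLocal, fderiv_apply_apply hd, ← christoffelBilin_apply]
  simp
  abel

theorem IsMetricOn.nablaCurvatureLocal_eq [CompleteSpace V] (hG : IsMetricOn G U) {y : V}
    (hy : y ∈ U) (e a b c : V) :
    let Γ := christoffelBilin G
    let R := curvatureTrilin Γ
    nablaCurvatureLocal G y e a b c = fderiv ℝ R y e a b c + Γ y e (R y a b c)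
      - R y (Γ y e a) b c - R y a (Γ y e b) c - R y a b (Γ y e c) := by
  intro Γ R
  have hd : DifferentiableAt ℝ R y :=
    ((contDiffOn_curvatureTrilin hG.isOpen hG.contDiffOn_christoffelBilin).contDiffAt
      (hG.isOpen.mem_nhds hy)).differentiableAt (by simp)
  have hR : (fun z ↦ curvatureLocal G z a b c) =ᶠ[𝓝 y] fun z ↦ R z a b c := by
    filter_upwards [hG.isOpen.mem_nhds hy] with z hz using hG.curvatureLocal_eq hz a b c
  have hn (b : V) : nablaLocal G (fun _ ↦ e) (fun _ ↦ b) y = Γ y e b := by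
    simp [nablaLocal, Γ, christoffelBilin_apply]
  rw [nablaCurvatureLocal, hn, hn, hn, hG.curvatureLocal_eq hy, hG.curvatureLocal_eq hy,
    hG.curvatureLocal_eq hy, nablaLocal, hR.fderiv_eq, hR.eq_of_nhds,
    fderiv_apply_apply (hd.clm_apply (differentiableAt_const a)),
    fderiv_clm_apply hd (differentiableAt_const a)]
  simp [Γ, R, christoffelBilin_apply]

/-! ### Algebraic symmetries of the curvature tensor -/

section Symmetries

variable [CompleteSpace V]

theorem IsMetricOn.fderiv_christoffelBilin_symm (hG : IsMetricOn G U) {y : V} (hy : y ∈ U)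
    (e a b : V) : fderiv ℝ (christoffelBilin G) y e a b =
      fderiv ℝ (christoffelBilin G) y e b a := by
  have hd := hG.differentiableAt_christoffelBilin hy
  rw [← fderiv_apply_apply hd, ← fderiv_apply_apply hd]
  have : (fun z ↦ christoffelBilin G z a b) =ᶠ[𝓝 y] fun z ↦ christoffelBilin G z b a := by
    filter_upwards [hG.isOpen.mem_nhds hy] with z hz using hG.christoffelBilin_symm hz a b
  rw [this.fderiv_eq]

theorem IsMetricOn.curvature_bianchi (hG : IsMetricOn G U) {y : V} (hy : y ∈ U) (a b c : V) :
    curvatureTrilin (christoffelBilin G) y a b c + curvatureTrilin (christoffelBilin G) y b c a +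
      curvatureTrilin (christoffelBilin G) y c a b = 0 := by
  have hs := hG.fderiv_christoffelBilin_symm hy
  simp only [curvatureTrilin_apply]
  rw [hs a b c, hs b c a, hs c a b, hG.christoffelBilin_symm hy b c,
    hG.christoffelBilin_symm hy a c, hG.christoffelBilin_symm hy b a]
  abel

/-- Differentiate ∇G = 0 once more and antisymmetrise in the two directions. The second derivatives
of G cancel, and so do the products G(Γ(a,c), Γ(b,d)); what remains is G(R(a,b)c, d) + G(c, R(a,b)d)
= 0. -/
theorem IsMetricOn.curvature_skew (hG : IsMetricOn G U) {y : V} (hy : y ∈ U) (a b c d : V) :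
    G y (curvatureTrilin (christoffelBilin G) y a b c) d =
      -G y (curvatureTrilin (christoffelBilin G) y a b d) c := by
  have hd := hG.differentiableAt_christoffelBilin hy
  have hGd := hG.differentiableAt hy
  have hG2 : ContDiffAt ℝ ∞ G y := hG.contDiffOn.contDiffAt (hG.isOpen.mem_nhds hy)
  have hdd : DifferentiableAt ℝ (fderiv ℝ G) y :=
    (hG2.fderiv_right (m := ∞) (by simp)).differentiableAt (by simp)
  have key (e a : V) : fderiv ℝ (fderiv ℝ G) y e a c d =
      G y (fderiv ℝ (christoffelBilin G) y e a c) d + G y c (fderiv ℝ (christoffelBilin G) y e a d)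
      + fderiv ℝ G y e (christoffelBilin G y a c) d
      + fderiv ℝ G y e c (christoffelBilin G y a d) := by
    have h1 : (fun z ↦ fderiv ℝ G z a c d) =ᶠ[𝓝 y] fun z ↦
        G z (christoffelBilin G z a c) d + G z c (christoffelBilin G z a d) := by
      filter_upwards [hG.isOpen.mem_nhds hy] with z hz using hG.fderiv_eq hz a c d
    have h2 := DFunLike.congr_fun (F := V →L[ℝ] ℝ) h1.fderiv_eq e
    have h3 (a c : V) : DifferentiableAt ℝ (fun z ↦ christoffelBilin G z a c) y :=
      (hd.clm_apply (differentiableAt_const a)).clm_apply (differentiableAt_const c)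
    rw [fderiv_apply_apply (hdd.clm_apply (differentiableAt_const a)),
      fderiv_clm_apply hdd (differentiableAt_const a),
      fderiv_fun_add ((hGd.clm_apply (h3 a c)).clm_apply (differentiableAt_const d))
        ((hGd.clm_apply (differentiableAt_const c)).clm_apply (h3 a d))] at h2
    simp only [add_apply] at h2
    rw [fderiv_clm_apply_apply hGd (h3 a c) (differentiableAt_const d),
      fderiv_clm_apply_apply hGd (differentiableAt_const c) (h3 a d),
      fderiv_apply_apply hd, fderiv_apply_apply hd] at h2
    simp at h2
    rw [h2]; ring
  have hsymm : fderiv ℝ (fderiv ℝ G) y a b c d = fderiv ℝ (fderiv ℝ G) y b a c d := by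
    rw [hG2.isSymmSndFDerivAt (by simp only [minSmoothness_of_isRCLikeNormedField]; exact ENat.LEInfty.out) a b]
  rw [key, key, hG.fderiv_eq hy, hG.fderiv_eq hy, hG.fderiv_eq hy, hG.fderiv_eq hy] at hsymm
  rw [hG.symm y hy _ c]
  simp only [curvatureTrilin_apply, map_add, map_sub, add_apply,
    sub_apply]
  linarith

/-- The classical consequence of four instances of the first Bianchi identity together with skewness
in each pair. -/
theorem IsMetricOn.curvature_pair_symm (hG : IsMetricOn G U) {y : V} (hy : y ∈ U) (a b c d : V) :
    G y (curvatureTrilin (christoffelBilin G) y a b c) d =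
      G y (curvatureTrilin (christoffelBilin G) y c d a) b := by
  have hB (a b c d : V) : G y (curvatureTrilin (christoffelBilin G) y a b c) d +
      G y (curvatureTrilin (christoffelBilin G) y b c a) d +
      G y (curvatureTrilin (christoffelBilin G) y c a b) d = 0 := by
    rw [← add_apply, ← add_apply, ← map_add, ← map_add,
      hG.curvature_bianchi hy]
    simp
  have hs (a b c d : V) : G y (curvatureTrilin (christoffelBilin G) y a b c) d =
      -G y (curvatureTrilin (christoffelBilin G) y b a c) d := by
    rw [curvatureTrilin_swap]; simp
  have h1 := hB a b c d
  have h2 := hB b c d a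
  have h3 := hB c d a b
  have h4 := hB d a b c
  have hk := hG.curvature_skew hy
  linarith [hk a b c d, hk a b d c, hk b c a d, hk c a b d, hk c d b a, hk d b c a, hk d a c b,
    hk a c d b, hk a b d c, hk b d a c, hk c d a b, hs a c d b, hs a c b d, hs b d c a, hs b d a c,
    hs a b c d, hs b c d a, hs c d a b, hs d a b c]

end Symmetries

end Metric

/-! ### Connections in a moving frame -/

section Frame

variable {V : Type*} [NormedAddCommGroup V] [NormedSpace ℝ V]
  {W : Type*} [NormedAddCommGroup W] [NormedSpace ℝ W]

/-- The curvature of a connection, expressed through its connection form in a moving frame `P`. -/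
theorem frame_curvatureTrilin {Γ : V → V →L[ℝ] V →L[ℝ] V} {P : V → V →L[ℝ] W}
    {A : V → W →L[ℝ] W →L[ℝ] W} {y : V} (hΓ : DifferentiableAt ℝ Γ y)
    (hP : ContDiffAt ℝ ∞ P y) (hA : DifferentiableAt ℝ A y)
    (h : ∀ᶠ z in 𝓝 y, ∀ a b, P z (Γ z a b) = fderiv ℝ P z a b + A z (P z a) (P z b))
    (a b c : V) :
    P y (curvatureTrilin Γ y a b c) =
      fderiv ℝ A y a (P y b) (P y c) - fderiv ℝ A y b (P y a) (P y c)
      + A y (fderiv ℝ P y a b - fderiv ℝ P y b a) (P y c)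
      + (A y (P y a) (A y (P y b) (P y c)) - A y (P y b) (A y (P y a) (P y c))) := by
  have hPd : DifferentiableAt ℝ P y := hP.differentiableAt (by simp)
  have hdd : DifferentiableAt ℝ (fderiv ℝ P) y :=
    (hP.fderiv_right (m := ∞) (by simp)).differentiableAt (by simp)
  have hPa (a : V) : DifferentiableAt ℝ (fun z ↦ P z a) y :=
    hPd.clm_apply (differentiableAt_const a)
  have hPa' (a e : V) : fderiv ℝ (fun z ↦ P z a) y e = fderiv ℝ P y e a := by
    rw [fderiv_clm_apply hPd (differentiableAt_const a)]; simp
  -- This is the defining relation `h` of the connection form, differentiated in the direction e.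
  have key (e a b : V) : P y (fderiv ℝ Γ y e a b) = fderiv ℝ (fderiv ℝ P) y e a b
      + (fderiv ℝ A y e (P y a) (P y b) + A y (fderiv ℝ P y e a) (P y b)
        + A y (P y a) (fderiv ℝ P y e b)) - fderiv ℝ P y e (Γ y a b) := by
    have h1 : (fun z ↦ P z (Γ z a b)) =ᶠ[𝓝 y]
        fun z ↦ fderiv ℝ P z a b + A z (P z a) (P z b) := by
      filter_upwards [h] with z hz using hz a b
    have hΓab : DifferentiableAt ℝ (fun z ↦ Γ z a b) y :=
      (hΓ.clm_apply (differentiableAt_const a)).clm_apply (differentiableAt_const b)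
    have h2 := DFunLike.congr_fun (F := V →L[ℝ] W) h1.fderiv_eq e
    rw [fderiv_clm_apply hPd hΓab, fderiv_fun_add
      ((hdd.clm_apply (differentiableAt_const a)).clm_apply (differentiableAt_const b))
      ((hA.clm_apply (hPa a)).clm_apply (hPa b))] at h2
    simp only [add_apply] at h2
    rw [fderiv_clm_apply_apply hA (hPa a) (hPa b), fderiv_apply_apply hdd, hPa', hPa'] at h2
    simp only [ContinuousLinearMap.comp_apply, fderiv_apply_apply hΓ,
      ContinuousLinearMap.flip_apply] at h2
    rw [← h2]; abel
  -- Antisymmetrising `key` removes the second derivatives of P; its terms ∂P(Γ) cancel against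
  -- those that `h` produces from the quadratic part of the curvature.
  have hsymm : fderiv ℝ (fderiv ℝ P) y a b c = fderiv ℝ (fderiv ℝ P) y b a c := by
    rw [hP.isSymmSndFDerivAt
      (by simp only [minSmoothness_of_isRCLikeNormedField]; exact ENat.LEInfty.out) a b]
  rw [curvatureTrilin_apply]
  simp only [map_add, map_sub, key, h.self_of_nhds, hsymm, sub_apply]
  abel

end Frame

/-! ### The Sasaki metric in coordinates -/

section SasakiLocal

/-- In finite dimension V and its dual have equal dimension, so nondegeneracy already permits
raising indices. -/
theorem isInvertible_of_injective {V : Type*} [NormedAddCommGroup V] [NormedSpace ℝ V]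
    [FiniteDimensional ℝ V] (B : V →L[ℝ] V →L[ℝ] ℝ) (h : ∀ v, (∀ w, B v w = 0) → v = 0) :
    B.IsInvertible := by
  let e : (V →ₗ[ℝ] ℝ) ≃ₗ[ℝ] (V →L[ℝ] ℝ) := LinearMap.toContinuousLinearMap
  have hinj : Function.Injective (B : V →ₗ[ℝ] V →L[ℝ] ℝ) := by
    rw [injective_iff_map_eq_zero]
    intro v hv
    exact h v fun w ↦ by
      have : B v = 0 := hv
      simp [this]
  have hdim : Module.finrank ℝ V = Module.finrank ℝ (V →L[ℝ] ℝ) := by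
    rw [← e.finrank_eq]; exact (Subspace.dual_finrank_eq (K := ℝ) (V := V)).symm
  refine ⟨(LinearEquiv.ofInjectiveOfFinrankEq (B : V →ₗ[ℝ] V →L[ℝ] ℝ) hinj
    hdim).toContinuousLinearEquiv, ?_⟩
  ext v w
  rfl

variable {V : Type*} [NormedAddCommGroup V] [NormedSpace ℝ V]

/-- The vertical part of a tangent vector of the tangent bundle in coordinates. -/
def verticalLocal (Γ : V → V →L[ℝ] V →L[ℝ] V) (z : V × V) : V × V →L[ℝ] V :=
  ContinuousLinearMap.snd ℝ V V + Γ z.1 z.2 ∘L ContinuousLinearMap.fst ℝ V V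

@[simp] theorem verticalLocal_apply (Γ : V → V →L[ℝ] V →L[ℝ] V) (z ξ : V × V) :
    verticalLocal Γ z ξ = ξ.2 + Γ z.1 z.2 ξ.1 := rfl

/-- The frame which splits a tangent vector of the tangent bundle into its horizontal part and its
vertical part. -/
def splitting (Γ : V → V →L[ℝ] V →L[ℝ] V) (z : V × V) : V × V →L[ℝ] V × V :=
  (ContinuousLinearMap.fst ℝ V V).prod (verticalLocal Γ z)

@[simp] theorem splitting_apply (Γ : V → V →L[ℝ] V →L[ℝ] V) (z ξ : V × V) :
    splitting Γ z ξ = (ξ.1, ξ.2 + Γ z.1 z.2 ξ.1) := rfl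

/-- The Sasaki metric in coordinates. -/
def sasakiLocal (G : V → V →L[ℝ] V →L[ℝ] ℝ) (z : V × V) : V × V →L[ℝ] V × V →L[ℝ] ℝ :=
  pullbackForm (G z.1) (ContinuousLinearMap.fst ℝ V V) +
    pullbackForm (G z.1) (verticalLocal (christoffelBilin G) z)

theorem sasakiLocal_apply (G : V → V →L[ℝ] V →L[ℝ] ℝ) (z ξ η : V × V) :
    sasakiLocal G z ξ η = G z.1 ξ.1 η.1 +
      G z.1 (ξ.2 + christoffelBilin G z.1 z.2 ξ.1) (η.2 + christoffelBilin G z.1 z.2 η.1) := rfl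

/-- The connection form of the Sasaki metric in the frame `splitting`. -/
def sasakiConnection (Γ : V → V →L[ℝ] V →L[ℝ] V) (z : V × V) :
    V × V →L[ℝ] V × V →L[ℝ] V × V :=
  let f := ContinuousLinearMap.fst ℝ V V
  let s := ContinuousLinearMap.snd ℝ V V
  let R := curvatureTrilin Γ z.1
  ContinuousLinearMap.compL ℝ (V × V) V (V × V) (ContinuousLinearMap.inl ℝ V V) ∘L
      ((Γ z.1).bilinearComp f f + (1 / 2 : ℝ) • (R z.2).flip.bilinearComp f s +
        (1 / 2 : ℝ) • (R z.2).bilinearComp s f) +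
    ContinuousLinearMap.compL ℝ (V × V) V (V × V) (ContinuousLinearMap.inr ℝ V V) ∘L
      ((Γ z.1).bilinearComp f s - (1 / 2 : ℝ) •
        (ContinuousLinearMap.compL ℝ V (V →L[ℝ] V) V (ContinuousLinearMap.apply ℝ V z.2) ∘L
          R).bilinearComp f f)

theorem sasakiConnection_apply (Γ : V → V →L[ℝ] V →L[ℝ] V) (z m n : V × V) :
    sasakiConnection Γ z m n =
      (Γ z.1 m.1 n.1 + (1 / 2 : ℝ) • curvatureTrilin Γ z.1 z.2 n.2 m.1 +
          (1 / 2 : ℝ) • curvatureTrilin Γ z.1 z.2 m.2 n.1,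
        Γ z.1 m.1 n.2 - (1 / 2 : ℝ) • curvatureTrilin Γ z.1 m.1 n.1 z.2) := by
  simp [sasakiConnection]

variable {G : V → V →L[ℝ] V →L[ℝ] ℝ} {U : Set V}

theorem contDiffOn_splitting [FiniteDimensional ℝ V] {Γ : V → V →L[ℝ] V →L[ℝ] V}
    (hΓ : ContDiffOn ℝ ∞ Γ U) :
    ContDiffOn ℝ ∞ (splitting Γ) (U ×ˢ Set.univ) := by
  have h1 : ContDiffOn ℝ ∞ (fun z : V × V ↦ Γ z.1) (U ×ˢ Set.univ) :=
    hΓ.comp contDiffOn_fst fun z hz ↦ hz.1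
  refine contDiffOn_clm_apply.2 fun ξ ↦ ?_
  simp only [splitting_apply]
  exact contDiffOn_const.prodMk (contDiffOn_const.add
    ((h1.clm_apply contDiffOn_snd).clm_apply contDiffOn_const))

theorem IsMetricOn.isMetricOn_sasakiLocal [FiniteDimensional ℝ V] (hG : IsMetricOn G U) :
    IsMetricOn (sasakiLocal G) (U ×ˢ (Set.univ : Set V)) where
  isOpen := hG.isOpen.prod isOpen_univ
  contDiffOn := by
    have : CompleteSpace V := FiniteDimensional.complete ℝ V
    have hΓ := hG.contDiffOn_christoffelBilin
    have h1 : ContDiffOn ℝ ∞ (fun z : V × V ↦ christoffelBilin G z.1) (U ×ˢ Set.univ) :=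
      hΓ.comp contDiffOn_fst fun z hz ↦ hz.1
    have h2 : ContDiffOn ℝ ∞ (fun z : V × V ↦ G z.1) (U ×ˢ Set.univ) :=
      hG.contDiffOn.comp contDiffOn_fst fun z hz ↦ hz.1
    refine contDiffOn_clm_apply.2 fun ξ ↦ contDiffOn_clm_apply.2 fun η ↦ ?_
    have h3 (ξ : V × V) : ContDiffOn ℝ ∞
        (fun z : V × V ↦ ξ.2 + christoffelBilin G z.1 z.2 ξ.1) (U ×ˢ Set.univ) :=
      contDiffOn_const.add ((h1.clm_apply contDiffOn_snd).clm_apply contDiffOn_const)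
    simp only [sasakiLocal_apply]
    exact ((h2.clm_apply contDiffOn_const).clm_apply contDiffOn_const).add
      ((h2.clm_apply (h3 ξ)).clm_apply (h3 η))
  symm z hz ξ η := by
    rw [sasakiLocal_apply, sasakiLocal_apply, hG.symm z.1 hz.1, hG.symm z.1 hz.1 (_ + _)]
  isInvertible z hz := by
    refine isInvertible_of_injective _ fun ξ hξ ↦ ?_
    have hnd (a : V) (h : ∀ w, G z.1 a w = 0) : a = 0 :=
      hG.eq_of_forall_apply_eq hz.1 fun w ↦ by simp [h]
    -- Testing against vertical vectors isolates the vertical part; once it vanishes, testing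
    -- against (w, 0) isolates the horizontal one.
    have h2 : ξ.2 + christoffelBilin G z.1 z.2 ξ.1 = 0 := hnd _ fun w ↦ by
      have := hξ (0, w)
      simpa [sasakiLocal_apply] using this
    have h1 : ξ.1 = 0 := hnd _ fun w ↦ by
      have := hξ (w, 0)
      simpa [sasakiLocal_apply, h2] using this
    rw [h1] at h2
    exact Prod.ext h1 (by simpa using h2)

section Derivatives

variable {Γ : V → V →L[ℝ] V →L[ℝ] V} {z : V × V}

theorem fderiv_comp_fst_apply {X : Type*} [NormedAddCommGroup X] [NormedSpace ℝ X]
    {B : V → X} (hB : DifferentiableAt ℝ B z.1) (e : V × V) :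
    fderiv ℝ (fun z : V × V ↦ B z.1) z e = fderiv ℝ B z.1 e.1 := by
  have := (hB.hasFDerivAt.comp z hasFDerivAt_fst).fderiv
  simp only [Function.comp_def] at this
  rw [this]; rfl

theorem differentiableAt_comp_fst {X : Type*} [NormedAddCommGroup X] [NormedSpace ℝ X]
    {B : V → X} (hB : DifferentiableAt ℝ B z.1) :
    DifferentiableAt ℝ (fun z : V × V ↦ B z.1) z :=
  hB.comp z differentiableAt_fst

theorem fderiv_apply_fst_snd {W₂ X : Type*} [NormedAddCommGroup W₂] [NormedSpace ℝ W₂]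
    [NormedAddCommGroup X] [NormedSpace ℝ X] {B : V → V →L[ℝ] W₂ →L[ℝ] X}
    (hB : DifferentiableAt ℝ B z.1) (a : W₂) (e : V × V) :
    fderiv ℝ (fun z : V × V ↦ B z.1 z.2 a) z e = fderiv ℝ B z.1 e.1 z.2 a + B z.1 e.2 a := by
  rw [fderiv_clm_apply_apply (B := fun z : V × V ↦ B z.1) (differentiableAt_comp_fst hB)
    differentiableAt_snd (differentiableAt_const a), fderiv_comp_fst_apply hB]
  simp [fderiv_snd]

theorem fderiv_splitting (hΓ : DifferentiableAt ℝ Γ z.1)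
    (hd : DifferentiableAt ℝ (splitting Γ) z) (e ξ : V × V) :
    fderiv ℝ (splitting Γ) z e ξ = (0, fderiv ℝ Γ z.1 e.1 z.2 ξ.1 + Γ z.1 e.2 ξ.1) := by
  have h1 : fderiv ℝ (fun z ↦ splitting Γ z ξ) z e = fderiv ℝ (splitting Γ) z e ξ := by
    rw [fderiv_clm_apply hd (differentiableAt_const ξ)]; simp
  have h2 : DifferentiableAt ℝ (fun z : V × V ↦ Γ z.1 z.2 ξ.1) z :=
    ((differentiableAt_comp_fst hΓ).clm_apply differentiableAt_snd).clm_apply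
      (differentiableAt_const _)
  rw [← h1]
  simp only [splitting_apply]
  rw [DifferentiableAt.fderiv_prodMk (differentiableAt_const _) (h2.const_add _)]
  simp [fderiv_apply_fst_snd hΓ, fderiv_const_add]

end Derivatives

/-- Identifies `sasakiConnection` as the Levi-Civita connection form in the frame: P(∇_ξ η) =
∂_ξ(Pη) + A(Pξ, Pη) for constant ξ, η. -/
theorem IsMetricOn.splitting_christoffelBilin [FiniteDimensional ℝ V] (hG : IsMetricOn G U)
    {z : V × V} (hz : z ∈ U ×ˢ (Set.univ : Set V)) (ξ η : V × V) :
    let Γ := christoffelBilin G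
    splitting Γ z (christoffelBilin (sasakiLocal G) z ξ η) =
      fderiv ℝ (splitting Γ) z ξ η +
        sasakiConnection Γ z (splitting Γ z ξ) (splitting Γ z η) := by
  intro Γ
  have : CompleteSpace V := FiniteDimensional.complete ℝ V
  have hS := hG.isMetricOn_sasakiLocal
  have hΓ : DifferentiableAt ℝ Γ z.1 := hG.differentiableAt_christoffelBilin hz.1
  have hGd := hG.differentiableAt hz.1
  have hPd : DifferentiableAt ℝ (splitting Γ) z :=
    ((contDiffOn_splitting hG.contDiffOn_christoffelBilin).contDiffAt
      (hS.isOpen.mem_nhds hz)).differentiableAt (by simp)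
  let N (ξ η : V × V) : V × V := fderiv ℝ (splitting Γ) z ξ η +
    sasakiConnection Γ z (splitting Γ z ξ) (splitting Γ z η)
  -- Q inverts the frame, so Q ∘ N is the candidate for the Christoffel symbols of ĝ.
  let Q (m : V × V) : V × V := (m.1, m.2 - Γ z.1 z.2 m.1)
  have hQ (m : V × V) : splitting Γ z (Q m) = m := by simp [Q]
  have hN (ξ η : V × V) : N ξ η = N η ξ := by
    simp only [N, fderiv_splitting hΓ hPd, sasakiConnection_apply, splitting_apply, Γ]
    refine Prod.ext ?_ ?_
    · simp only [Prod.fst_add, zero_add]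
      rw [hG.christoffelBilin_symm hz.1 ξ.1]
      abel
    · simp only [Prod.snd_add, map_add]
      -- Torsion: antisymmetrising the terms in Γ and ∂Γ gives R(ξ₁, η₁)u, which the two terms with
      -- coefficient -½ cancel.
      rw [hG.christoffelBilin_symm hz.1 ξ.1 η.2, hG.christoffelBilin_symm hz.1 η.1 ξ.2,
        curvatureTrilin_apply, curvatureTrilin_apply, hG.christoffelBilin_symm hz.1 ξ.1 z.2,
        hG.christoffelBilin_symm hz.1 η.1 z.2, hG.fderiv_christoffelBilin_symm hz.1 ξ.1 z.2,
        hG.fderiv_christoffelBilin_symm hz.1 η.1 z.2]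
      module
  have key := hS.christoffelBilin_eq hz (fun ξ η ↦ Q (N ξ η)) (fun ξ η ↦ by simp only [hN ξ η])
    (fun ξ η ζ ↦ ?_) ξ η
  · rw [key]; exact hQ _
  · have h3 (η : V × V) : DifferentiableAt ℝ (fun z : V × V ↦ η.2 + Γ z.1 z.2 η.1) z :=
      (differentiableAt_const _).add
        (((differentiableAt_comp_fst hΓ).clm_apply differentiableAt_snd).clm_apply
          (differentiableAt_const _))
    have h4 (η : V × V) : fderiv ℝ (fun z : V × V ↦ η.2 + Γ z.1 z.2 η.1) z ξ =
        fderiv ℝ Γ z.1 ξ.1 z.2 η.1 + Γ z.1 ξ.2 η.1 := by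
      rw [fderiv_const_add, fderiv_apply_fst_snd hΓ]
    have hG1 : DifferentiableAt ℝ (fun z : V × V ↦ G z.1) z := differentiableAt_comp_fst hGd
    have hQ1 (m ζ : V × V) : sasakiLocal G z (Q m) ζ = G z.1 m.1 ζ.1 +
        G z.1 m.2 (ζ.2 + Γ z.1 z.2 ζ.1) := by simp [Q, Γ, sasakiLocal_apply]
    have hQ2 (m η : V × V) : sasakiLocal G z η (Q m) = G z.1 η.1 m.1 +
        G z.1 (η.2 + Γ z.1 z.2 η.1) m.2 := by simp [Q, Γ, sasakiLocal_apply]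
    rw [← fderiv_apply_apply (hS.differentiableAt hz), hQ1, hQ2]
    simp only [sasakiLocal_apply]
    rw [fderiv_fun_add ((hG1.clm_apply (differentiableAt_const _)).clm_apply
      (differentiableAt_const _)) ((hG1.clm_apply (h3 η)).clm_apply (h3 ζ))]
    simp only [add_apply]
    rw [fderiv_apply_apply hG1, fderiv_clm_apply_apply hG1 (h3 η) (h3 ζ), h4, h4,
      fderiv_comp_fst_apply hGd, hG.fderiv_eq hz.1, hG.fderiv_eq hz.1]
    simp only [N, fderiv_splitting hΓ hPd, sasakiConnection_apply, splitting_apply, Prod.fst_add,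
      Prod.snd_add, zero_add]
    -- Compatibility: the terms with R(u, ξ^v) cancel by skewness, and pair symmetry makes ½R(u, ·)·
    -- the adjoint of ½R(·, ·)u, so the remaining ones cancel too.
    have e1 := hG.curvature_skew hz.1 z.2 (ξ.2 + Γ z.1 z.2 ξ.1) η.1 ζ.1
    have e2 := hG.curvature_pair_symm hz.1 z.2 (η.2 + Γ z.1 z.2 η.1) ξ.1 ζ.1
    have e3 := hG.curvature_pair_symm hz.1 z.2 (ζ.2 + Γ z.1 z.2 ζ.1) ξ.1 η.1
    have e4 := hG.symm z.1 hz.1 (curvatureTrilin Γ z.1 z.2 (ξ.2 + Γ z.1 z.2 ξ.1) ζ.1) η.1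
    have e5 := hG.symm z.1 hz.1 (curvatureTrilin Γ z.1 z.2 (ζ.2 + Γ z.1 z.2 ζ.1) ξ.1) η.1
    have e6 := hG.symm z.1 hz.1 (curvatureTrilin Γ z.1 ξ.1 ζ.1 z.2) (η.2 + Γ z.1 z.2 η.1)
    simp only [map_add, map_sub, map_smul, add_apply, sub_apply, smul_apply, smul_eq_mul, Γ]
      at e1 e2 e3 e4 e5 e6 ⊢
    linarith

end SasakiLocal

/-! ### The curvature of the Sasaki metric in coordinates -/

section SasakiCurvature

variable {V : Type*} [NormedAddCommGroup V] [NormedSpace ℝ V]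

/-- The horizontal lift of a vector in coordinates. -/
def horizontalLocal (Γ : V → V →L[ℝ] V →L[ℝ] V) (z : V × V) (a : V) : V × V :=
  (a, -Γ z.1 z.2 a)

theorem splitting_horizontalLocal (Γ : V → V →L[ℝ] V →L[ℝ] V) (z : V × V) (a : V) :
    splitting Γ z (horizontalLocal Γ z a) = (a, 0) := by
  simp [horizontalLocal]

theorem splitting_vertical (Γ : V → V →L[ℝ] V →L[ℝ] V) (z : V × V) (a : V) :
    splitting Γ z (0, a) = (0, a) := by
  simp

theorem sasakiLocal_eq_splitting (G : V → V →L[ℝ] V →L[ℝ] ℝ) (z ξ η : V × V) :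
    sasakiLocal G z ξ η =
      G z.1 (splitting (christoffelBilin G) z ξ).1 (splitting (christoffelBilin G) z η).1 +
      G z.1 (splitting (christoffelBilin G) z ξ).2 (splitting (christoffelBilin G) z η).2 := rfl

variable [FiniteDimensional ℝ V] {G : V → V →L[ℝ] V →L[ℝ] ℝ} {U : Set V}

theorem contDiffOn_sasakiConnection {Γ : V → V →L[ℝ] V →L[ℝ] V} (hU : IsOpen U)
    (hΓ : ContDiffOn ℝ ∞ Γ U) :
    ContDiffOn ℝ ∞ (sasakiConnection Γ) (U ×ˢ (Set.univ : Set V)) := by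
  have h1 : ContDiffOn ℝ ∞ (fun z : V × V ↦ Γ z.1) (U ×ˢ Set.univ) :=
    hΓ.comp contDiffOn_fst fun z hz ↦ hz.1
  have h2 : ContDiffOn ℝ ∞ (fun z : V × V ↦ curvatureTrilin Γ z.1) (U ×ˢ Set.univ) :=
    (contDiffOn_curvatureTrilin hU hΓ).comp contDiffOn_fst fun z hz ↦ hz.1
  refine contDiffOn_clm_apply.2 fun m ↦ contDiffOn_clm_apply.2 fun n ↦ ?_
  simp only [sasakiConnection_apply]
  have hc (a : V) : ContDiffOn ℝ ∞ (fun _ : V × V ↦ a) (U ×ˢ Set.univ) := contDiffOn_const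
  have hs : ContDiffOn ℝ ∞ (fun z : V × V ↦ z.2) (U ×ˢ Set.univ) := contDiffOn_snd
  have h3 (a b : V) := (((h2.clm_apply hs).clm_apply (hc a)).clm_apply (hc b)).const_smul (1/2 : ℝ)
  have h4 (a b : V) := (((h2.clm_apply (hc a)).clm_apply (hc b)).clm_apply hs).const_smul (1/2 : ℝ)
  have h5 (a b : V) := (h1.clm_apply (hc a)).clm_apply (hc b)
  exact (((h5 _ _).add (h3 _ _)).add (h3 _ _)).prodMk ((h5 _ _).sub (h4 _ _))

theorem fderiv_sasakiConnection {Γ : V → V →L[ℝ] V →L[ℝ] V} {z : V × V} (hU : IsOpen U)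
    (hΓ : ContDiffOn ℝ ∞ Γ U) (hz : z ∈ U ×ˢ (Set.univ : Set V)) (e m n : V × V) :
    let R := curvatureTrilin Γ
    fderiv ℝ (sasakiConnection Γ) z e m n =
      (fderiv ℝ Γ z.1 e.1 m.1 n.1
          + (1 / 2 : ℝ) • (fderiv ℝ R z.1 e.1 z.2 n.2 m.1 + R z.1 e.2 n.2 m.1)
          + (1 / 2 : ℝ) • (fderiv ℝ R z.1 e.1 z.2 m.2 n.1 + R z.1 e.2 m.2 n.1),
        fderiv ℝ Γ z.1 e.1 m.1 n.2
          - (1 / 2 : ℝ) • (fderiv ℝ R z.1 e.1 m.1 n.1 z.2 + R z.1 m.1 n.1 e.2)) := by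
  intro R
  have hd : DifferentiableAt ℝ (sasakiConnection Γ) z :=
    ((contDiffOn_sasakiConnection hU hΓ).contDiffAt
      ((hU.prod isOpen_univ).mem_nhds hz)).differentiableAt (by simp)
  have hΓd : DifferentiableAt ℝ Γ z.1 :=
    (hΓ.contDiffAt (hU.mem_nhds hz.1)).differentiableAt (by simp)
  have hRd : DifferentiableAt ℝ R z.1 :=
    ((contDiffOn_curvatureTrilin hU hΓ).contDiffAt (hU.mem_nhds hz.1)).differentiableAt (by simp)
  have hΓ1 : DifferentiableAt ℝ (fun z : V × V ↦ Γ z.1) z := differentiableAt_comp_fst hΓd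
  have hR1 : DifferentiableAt ℝ (fun z : V × V ↦ R z.1) z := differentiableAt_comp_fst hRd
  have hc (a : V) : DifferentiableAt ℝ (fun _ : V × V ↦ a) z := differentiableAt_const a
  have hs : DifferentiableAt ℝ (fun z : V × V ↦ z.2) z := differentiableAt_snd
  have h3 (a b : V) : HasFDerivAt (fun z : V × V ↦ (1 / 2 : ℝ) • R z.1 z.2 a b) _ z :=
    (((hR1.clm_apply hs).clm_apply (hc a)).clm_apply (hc b)).hasFDerivAt.const_smul (1 / 2 : ℝ)
  have h4 (a b : V) : HasFDerivAt (fun z : V × V ↦ (1 / 2 : ℝ) • R z.1 a b z.2) _ z :=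
    (((hR1.clm_apply (hc a)).clm_apply (hc b)).clm_apply hs).hasFDerivAt.const_smul (1 / 2 : ℝ)
  have h5 (a b : V) := ((hΓ1.clm_apply (hc a)).clm_apply (hc b)).hasFDerivAt
  have h6 := ((((h5 m.1 n.1).add (h3 n.2 m.1)).add (h3 m.2 n.1)).prodMk
    ((h5 m.1 n.2).sub (h4 m.1 n.1))).fderiv
  have h3' (a b : V) : fderiv ℝ (fun z : V × V ↦ R z.1 z.2 a b) z e =
      fderiv ℝ R z.1 e.1 z.2 a b + R z.1 e.2 a b := by
    rw [fderiv_clm_apply ((hR1.clm_apply hs).clm_apply (hc a)) (hc b)]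
    simp [fderiv_apply_fst_snd hRd]
  have h4' (a b : V) : fderiv ℝ (fun z : V × V ↦ R z.1 a b z.2) z e =
      fderiv ℝ R z.1 e.1 a b z.2 + R z.1 a b e.2 := by
    rw [fderiv_clm_apply_apply (hR1.clm_apply (hc a)) (hc b) hs,
      fderiv_clm_apply hR1 (hc a)]
    simp [fderiv_comp_fst_apply hRd, fderiv_snd]
  have h5' (a b : V) : fderiv ℝ (fun z : V × V ↦ Γ z.1 a b) z e = fderiv ℝ Γ z.1 e.1 a b := by
    rw [fderiv_apply_apply hΓ1, fderiv_comp_fst_apply hΓd]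
  rw [← fderiv_apply_apply hd]
  have h7 : (fun z ↦ sasakiConnection Γ z m n) = fun z : V × V ↦
      (Γ z.1 m.1 n.1 + (1 / 2 : ℝ) • R z.1 z.2 n.2 m.1 + (1 / 2 : ℝ) • R z.1 z.2 m.2 n.1,
        Γ z.1 m.1 n.2 - (1 / 2 : ℝ) • R z.1 m.1 n.1 z.2) :=
    funext fun z ↦ sasakiConnection_apply Γ z m n
  rw [h7]
  refine (DFunLike.congr_fun (F := V × V →L[ℝ] V × V) h6 e).trans ?_
  simp only [ContinuousLinearMap.prod_apply, add_apply, sub_apply, smul_apply, h3', h4', h5']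

/-- The structure equation for the Sasaki frame. The antisymmetrised derivative of the frame is
purely vertical because the horizontal component of `splitting` is constant. -/
theorem IsMetricOn.splitting_curvatureLocal (hG : IsMetricOn G U) {z : V × V}
    (hz : z ∈ U ×ˢ (Set.univ : Set V)) (ξ η ζ : V × V) :
    let Γ := christoffelBilin G
    let P := splitting Γ z
    let A := sasakiConnection Γ
    P (curvatureLocal (sasakiLocal G) z ξ η ζ) =
      fderiv ℝ A z ξ (P η) (P ζ) - fderiv ℝ A z η (P ξ) (P ζ)
      + A z (0, fderiv ℝ Γ z.1 ξ.1 z.2 η.1 + Γ z.1 ξ.2 η.1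
          - (fderiv ℝ Γ z.1 η.1 z.2 ξ.1 + Γ z.1 η.2 ξ.1)) (P ζ)
      + (A z (P ξ) (A z (P η) (P ζ)) - A z (P η) (A z (P ξ) (P ζ))) := by
  intro Γ P A
  have : CompleteSpace V := FiniteDimensional.complete ℝ V
  have hS := hG.isMetricOn_sasakiLocal
  have hn := hS.isOpen.mem_nhds hz
  have hP := (contDiffOn_splitting hG.contDiffOn_christoffelBilin).contDiffAt hn
  rw [hS.curvatureLocal_eq hz, frame_curvatureTrilin (hS.differentiableAt_christoffelBilin hz) hP
    (((contDiffOn_sasakiConnection hG.isOpen hG.contDiffOn_christoffelBilin).contDiffAt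
      hn).differentiableAt (by simp))
    (Filter.eventually_of_mem hn fun z hz a b ↦ hG.splitting_christoffelBilin hz a b),
    fderiv_splitting (hG.differentiableAt_christoffelBilin hz.1) (hP.differentiableAt (by simp)),
    fderiv_splitting (hG.differentiableAt_christoffelBilin hz.1) (hP.differentiableAt (by simp))]
  simp [P, A, Γ]

/-! ### Curvature on horizontal and vertical lifts -/

section Lifts

variable (hG : IsMetricOn G U) {p : V} (hp : p ∈ U) (u x y z w : V)
include hG hp

-- The structure equation evaluated on lifts. Where only the vertical component is recorded, the
-- curvature is later paired with W^V alone.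
set_option linter.unusedSimpArgs false in
set_option maxHeartbeats 1000000 in
theorem IsMetricOn.splitting_curvature_lifts :
    let R := curvatureLocal G p
    let D := nablaCurvatureLocal G p
    let h := horizontalLocal (christoffelBilin G) (p, u)
    let P := splitting (christoffelBilin G) (p, u)
    let S := curvatureLocal (sasakiLocal G) (p, u)
    P (S (h x) (h y) (h z)) =
      (R x y z + (1 / 4 : ℝ) • R u (R z y u) x + (1 / 4 : ℝ) • R u (R x z u) y
        + (1 / 2 : ℝ) • R u (R x y u) z,
        -(1 / 2 : ℝ) • (D x y z u - D y x z u)) ∧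
    (P (S (h x) (h y) (0, z))).2 =
      R x y z + (1 / 4 : ℝ) • R (R u z y) x u - (1 / 4 : ℝ) • R (R u z x) y u ∧
    P (S (h x) (0, y) (h z)) =
      ((1 / 2 : ℝ) • D x u y z, (1 / 4 : ℝ) • R (R u y z) x u + (1 / 2 : ℝ) • R x z y) ∧
    (P (S (h x) (0, y) (0, z))).2 = 0 ∧
    P (S (0, x) (0, y) (h z)) =
      (R x y z + (1 / 4 : ℝ) • (R u x (R u y z) - R u y (R u x z)), 0) ∧
    (P (S (0, x) (0, y) (0, z))).2 = 0 := by
  intro R D h P S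
  have : CompleteSpace V := FiniteDimensional.complete ℝ V
  have hz : (p, u) ∈ U ×ˢ (Set.univ : Set V) := ⟨hp, trivial⟩
  have hΓ := hG.contDiffOn_christoffelBilin
  have hs := hG.christoffelBilin_symm hp
  refine ⟨?_, ?_, ?_, ?_, ?_, ?_⟩
  all_goals
    simp only [S, P]
    rw [hG.splitting_curvatureLocal hz, fderiv_sasakiConnection hG.isOpen hΓ hz,
      fderiv_sasakiConnection hG.isOpen hΓ hz]
    simp only [h, splitting_horizontalLocal, splitting_vertical, R, D, hG.curvatureLocal_eq hp,
      hG.nablaCurvatureLocal_eq hp]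
    simp only [horizontalLocal, sasakiConnection_apply]
    simp only [map_add, map_sub, map_neg, map_zero, map_smul, add_apply, sub_apply, neg_apply,
      zero_apply, smul_apply, add_zero, zero_add, sub_zero, zero_sub, smul_zero, neg_zero,
      Prod.fst_add, Prod.fst_sub, Prod.snd_add, Prod.snd_sub]
  -- R(x,y)z and R(x,y)u are expanded because the left side contains the matching raw terms in ∂Γ
  -- and ΓΓ; symmetry of Γ then aligns them.
  · rw [curvatureTrilin_apply _ p x y z, curvatureTrilin_apply _ p x y u,
      curvatureTrilin_swap _ p y z u, hG.fderiv_christoffelBilin_symm hp x u y,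
      hG.fderiv_christoffelBilin_symm hp y u x, hs (christoffelBilin G p u x) y,
      hs (christoffelBilin G p u y) x, hs u x, hs u y, hs y x]
    refine Prod.ext ?_ ?_
    · simp only [Prod.fst_add, Prod.fst_sub, map_add, map_sub, map_neg, add_apply, sub_apply,
        neg_apply]
      module
    · simp only [Prod.snd_add, Prod.snd_sub]
      module
  · rw [curvatureTrilin_apply _ p x y z, curvatureTrilin_swap _ p _ x u,
      curvatureTrilin_swap _ p _ y u]
    module
  · rw [curvatureTrilin_swap _ p _ x u, hs u x, hs y x]
    refine Prod.ext ?_ ?_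
    · simp only [Prod.fst_add, Prod.fst_sub]
      module
    · simp only [Prod.snd_add, Prod.snd_sub]
      module
  · rw [curvatureTrilin_swap _ p x y z]
    refine Prod.ext ?_ ?_
    · simp only [Prod.fst_add, Prod.fst_sub]
      module
    · simp

/-- The curvature of the Sasaki metric on horizontal and vertical lifts, in coordinates. -/
theorem IsMetricOn.sasakiLocal_curvatureLocal :
    let R := curvatureLocal G p
    let D := nablaCurvatureLocal G p
    let h := horizontalLocal (christoffelBilin G) (p, u)
    let S := fun a b c d ↦ sasakiLocal G (p, u) (curvatureLocal (sasakiLocal G) (p, u) a b c) d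
    S (h x) (h y) (h z) (h w) = G p (R x y z) w
      + 1 / 4 * (G p (R w x u) (R y z u) - G p (R w y u) (R x z u))
      + 1 / 2 * G p (R x y u) (R z w u) ∧
    S (h x) (h y) (h z) (0, w) = -(1 / 2) * G p (D x y z u - D y x z u) w ∧
    S (h x) (h y) (0, z) (0, w) = G p (R x y z) w
      - 1 / 4 * (G p (R u w x) (R u z y) - G p (R u w y) (R u z x)) ∧
    S (h x) (0, y) (h z) (h w) = 1 / 2 * G p (D x u y z) w ∧
    S (h x) (0, y) (h z) (0, w) = 1 / 2 * G p (R x z y) w - 1 / 4 * G p (R u y z) (R u w x) ∧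
    S (0, x) (0, y) (h z) (h w) = G p (R x y z) w
      - 1 / 4 * (G p (R u y z) (R u x w) - G p (R u x z) (R u y w)) ∧
    S (0, x) (0, y) (h z) (0, w) = 0 ∧
    S (h x) (0, y) (0, z) (0, w) = 0 ∧
    S (0, x) (0, y) (0, z) (0, w) = 0 := by
  intro R D h S
  have : CompleteSpace V := FiniteDimensional.complete ℝ V
  obtain ⟨h1, h2, h3, h4, h5, h6⟩ := hG.splitting_curvature_lifts hp u x y z
  have hsw (a b c : V) : R b a c = -R a b c := by
    simp only [R, hG.curvatureLocal_eq hp, curvatureTrilin_swap _ p a b c]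
  have hskew (a b c d : V) : G p (R a b c) d = -G p (R a b d) c := by
    simpa only [R, hG.curvatureLocal_eq hp] using hG.curvature_skew hp a b c d
  have hpair (a b c d : V) : G p (R a b c) d = G p (R c d a) b := by
    simpa only [R, hG.curvatureLocal_eq hp] using hG.curvature_pair_symm hp a b c d
  have hsy := hG.symm p hp
  -- The two patterns of nested curvature; each is turned into an inner product of two single
  -- curvature terms.
  have hk1 (a b c d : V) : G p (R u (R a b u) c) d = G p (R c d u) (R a b u) := hpair _ _ _ _
  have hk2 (a b c : V) : G p (R (R u a b) c u) w = -G p (R u w c) (R u a b) := by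
    rw [hpair, hskew]
  simp only [S, sasakiLocal_eq_splitting]
  rw [h1, h2, h3, h4, h5, h6]
  simp only [h, splitting_horizontalLocal, splitting_vertical, map_zero, map_add, map_sub, map_smul,
    add_apply, sub_apply, smul_apply, zero_apply, add_zero, zero_add, smul_eq_mul,
    show curvatureLocal G p = R from rfl, show nablaCurvatureLocal G p = D from rfl, hk1, hk2]
  refine ⟨?_, trivial, ?_, trivial, ?_, ?_, trivial, trivial, trivial⟩
  · rw [hsw w x u, hsw z y u, hsw w y u, hsy (R x y u)]
    simp only [map_neg, neg_apply]
    ring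
  · rw [hsy (R u w x)]
    ring
  · rw [hsy (R u w x)]
    ring
  · rw [hskew u x (R u y z), hskew u y (R u x z), hsy (R u x w), hsy (R u y w)]
    ring

end Lifts

end SasakiCurvature

/-! ### Metrics in charts -/

section Charts

variable {E : Type*} [NormedAddCommGroup E] [NormedSpace ℝ E]
  {H : Type*} [TopologicalSpace H] {I : ModelWithCorners ℝ E H}
  {M : Type*} [TopologicalSpace M] [ChartedSpace H M] [IsManifold I ∞ M]

/-- The tangent space at q is modelled on E by the preferred chart at q, so the differential of the
inverse chart at p is a change of coordinates from p to q. -/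
theorem mfderivWithin_extChartAt_symm_eq_tangentCoordChange {p q : M}
    (hq : q ∈ (chartAt H p).source) :
    mfderivWithin 𝓘(ℝ, E) I (extChartAt I p).symm (Set.range I) (extChartAt I p q) =
      tangentCoordChange I p q q := by
  rw [← TangentBundle.symmL_trivializationAt hq,
    TangentBundle.symmL_trivializationAt_eq_core hq]

theorem metricInChart_extChartAt (g : BilinField I M) {p q : M}
    (hq : q ∈ (chartAt H p).source) (a b : E) :
    metricInChart g p (extChartAt I p q) a b =
      g q (tangentCoordChange I p q q a) (tangentCoordChange I p q q b) := by
  have h : (extChartAt I p).symm (extChartAt I p q) = q :=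
    (extChartAt I p).left_inv (by rwa [extChartAt_source])
  have h2 := mfderivWithin_extChartAt_symm_eq_tangentCoordChange (I := I) hq
  -- The base point occurs in the type of the form, so it is replaced by q through a variable r.
  have key : ∀ (r : M) (_ : r = q) (A : E →L[ℝ] TangentSpace I r) (B : E →L[ℝ] E),
      (A : E →L[ℝ] E) = B → pullbackForm (g r) A a b = g q (B a) (B b) := by
    rintro r rfl A B hAB
    subst hAB
    rfl
  exact key _ h _ _ h2

theorem metricInChart_self (g : BilinField I M) (p : M) (a b : E) :
    metricInChart g p (extChartAt I p p) a b = g p a b := by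
  rw [metricInChart_extChartAt g (mem_chart_source H p)]
  have h (a : E) : tangentCoordChange I p p p a = a :=
    tangentCoordChange_self (mem_extChartAt_source p)
  rw [h, h]

theorem trivializationAt_bilinField (g : BilinField I M) {p q : M}
    (hq : q ∈ (chartAt H p).source) :
    (trivializationAt (E →L[ℝ] E →L[ℝ] ℝ)
      (fun p : M ↦ TangentSpace I p →L[ℝ] TangentSpace I p →L[ℝ] ℝ) p
      (Bundle.TotalSpace.mk' (E →L[ℝ] E →L[ℝ] ℝ) q (g q))).2 =
      metricInChart g p (extChartAt I p q) := by
  ext a b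
  rw [hom_trivializationAt_apply, metricInChart_extChartAt g hq]
  erw [inCoordinates_apply_eq₂ hq hq (by simp)]
  have hs (a : E) : (trivializationAt E (TangentSpace I) p).symm q a =
      tangentCoordChange I p q q a := by
    have h := DFunLike.congr_fun (F := E →L[ℝ] E)
      (TangentBundle.symmL_trivializationAt_eq_core (I := I) hq) a
    exact ((trivializationAt E (TangentSpace I) p).symmL_apply (R := ℝ) hq a).symm.trans h
  rw [hs, hs]
  exact DFunLike.congr_fun (F := ℝ →ₗ[ℝ] ℝ)
    (Bundle.Trivial.linearMapAt_trivialization ℝ M ℝ q) _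

/-- The bundle trivialization over a chart reads a field of forms as its coordinate expression; this
transfers smoothness in both directions. -/
theorem contMDiff_bilinField_iff [I.Boundaryless] (g : BilinField I M) :
    ContMDiff I (I.prod 𝓘(ℝ, E →L[ℝ] E →L[ℝ] ℝ)) ∞
      (fun p ↦ Bundle.TotalSpace.mk' (E →L[ℝ] E →L[ℝ] ℝ)
        (E := fun p : M ↦ TangentSpace I p →L[ℝ] TangentSpace I p →L[ℝ] ℝ) p (g p)) ↔
    ∀ p, ContDiffOn ℝ ∞ (metricInChart g p) (extChartAt I p).target := by
  constructor
  · intro h p y hy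
    have hq := (extChartAt I p).map_target hy
    rw [extChartAt_source] at hq
    have h1 := ((trivializationAt (E →L[ℝ] E →L[ℝ] ℝ)
      (fun p : M ↦ TangentSpace I p →L[ℝ] TangentSpace I p →L[ℝ] ℝ) p).contMDiffAt_section_iff
        (IB := I) (n := ∞) (s := g) (x₀ := (extChartAt I p).symm y) (by simpa using hq)).1 (h _)
    have h2 : ContMDiffAt I 𝓘(ℝ, E →L[ℝ] E →L[ℝ] ℝ) ∞
        (fun q ↦ metricInChart g p (extChartAt I p q)) ((extChartAt I p).symm y) := by
      refine h1.congr_of_eventuallyEq ?_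
      filter_upwards [(chartAt H p).open_source.mem_nhds hq] with q hq
      exact (trivializationAt_bilinField g hq).symm
    have h3 := h2.comp y ((contMDiffOn_extChartAt_symm (n := ∞) p).contMDiffAt
      ((isOpen_extChartAt_target p).mem_nhds hy))
    refine (h3.contDiffAt.congr_of_eventuallyEq ?_).contDiffWithinAt
    filter_upwards [(isOpen_extChartAt_target p).mem_nhds hy] with z hz
    simp only [Function.comp_apply, (extChartAt I p).right_inv hz]
  · intro h p
    rw [Bundle.contMDiffAt_section]
    have h1 : ContMDiffAt I 𝓘(ℝ, E →L[ℝ] E →L[ℝ] ℝ) ∞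
        (fun q ↦ metricInChart g p (extChartAt I p q)) p :=
      (((h p).contDiffAt (extChartAt_target_mem_nhds p)).contMDiffAt).comp p contMDiffAt_extChartAt
    refine h1.congr_of_eventuallyEq ?_
    filter_upwards [(chartAt H p).open_source.mem_nhds (mem_chart_source H p)] with q hq
    exact trivializationAt_bilinField g hq

theorem tangentCoordChange_tangentCoordChange {p q r : M} (hp : r ∈ (chartAt H p).source)
    (hq : r ∈ (chartAt H q).source) (a : E) :
    tangentCoordChange I q p r (tangentCoordChange I p q r a) = a := by
  rw [← extChartAt_source I] at hp hq
  rw [tangentCoordChange_comp ⟨⟨hp, hq⟩, hp⟩, tangentCoordChange_self hp]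

theorem IsPseudoRiemannian.isMetricOn_metricInChart [I.Boundaryless] [FiniteDimensional ℝ E]
    {g : BilinField I M} (hg : IsPseudoRiemannian I g) (p : M) :
    IsMetricOn (metricInChart g p) (extChartAt I p).target where
  isOpen := isOpen_extChartAt_target p
  contDiffOn := (contMDiff_bilinField_iff g).1 hg.contMDiff p
  symm y _ a b := hg.symm _ _ _
  isInvertible y hy := by
    refine isInvertible_of_injective _ fun a ha ↦ ?_
    have hq := (extChartAt I p).map_target hy
    rw [extChartAt_source] at hq
    rw [← (extChartAt I p).right_inv hy] at ha
    generalize (extChartAt I p).symm y = q at ha hq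
    have hq' := mem_chart_source H q
    -- Every tangent vector at q is the image of a coordinate vector, since coordinate changes are
    -- invertible.
    have h : (tangentCoordChange I p q q a : E) = 0 :=
      hg.nondegenerate q (tangentCoordChange I p q q a) fun w ↦ by
        have := ha (tangentCoordChange I q p q w)
        rw [metricInChart_extChartAt g hq] at this
        exact (congrArg (g q (tangentCoordChange I p q q a))
          (tangentCoordChange_tangentCoordChange (I := I) hq' hq w)).symm.trans this
    rw [← tangentCoordChange_tangentCoordChange (I := I) hq hq' a, h, map_zero]

theorem isPseudoRiemannian_of_isMetricOn [I.Boundaryless]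
    {g : BilinField I M} (h : ∀ p, IsMetricOn (metricInChart g p) (extChartAt I p).target) :
    IsPseudoRiemannian I g where
  symm p v w := by
    exact (metricInChart_self g p v w).symm.trans
      (((h p).symm _ (mem_extChartAt_target p) v w).trans (metricInChart_self g p w v))
  nondegenerate p v hv :=
    (h p).eq_of_forall_apply_eq (mem_extChartAt_target p) (a := v) (b := (0 : E)) fun w ↦
      (metricInChart_self g p v w).trans ((hv w).trans (by simp))
  contMDiff := (contMDiff_bilinField_iff g).2 fun p ↦ (h p).contDiffOn

/-- The metrics in two charts are related by the change of coordinates. -/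
theorem metricInChart_coordChange [I.Boundaryless] (g : BilinField I M) {p q r : M}
    (hp : r ∈ (chartAt H p).source) (hq : r ∈ (chartAt H q).source) (a b : E) :
    metricInChart g p (extChartAt I p r) a b = metricInChart g q (extChartAt I q r)
      (tangentCoordChange I p q r a) (tangentCoordChange I p q r b) := by
  have hr := mem_chart_source H r
  rw [metricInChart_extChartAt g hp, metricInChart_extChartAt g hq]
  rw [← extChartAt_source I] at hp hq hr
  rw [tangentCoordChange_comp ⟨⟨hp, hq⟩, hr⟩, tangentCoordChange_comp ⟨⟨hp, hq⟩, hr⟩]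

theorem fderiv_coordChange [I.Boundaryless] {p q r : M}
    (hp : r ∈ (chartAt H p).source) (hq : r ∈ (chartAt H q).source) :
    fderiv ℝ (extChartAt I q ∘ (extChartAt I p).symm) (extChartAt I p r) =
      tangentCoordChange I p q r := by
  have := hasFDerivWithinAt_tangentCoordChange (I := I) (x := p) (y := q) (z := r)
    ⟨by rwa [extChartAt_source], by rwa [extChartAt_source]⟩
  rw [I.range_eq_univ, hasFDerivWithinAt_univ] at this
  exact this.fderiv

theorem contDiffAt_coordChange [I.Boundaryless] {p q r : M}
    (hp : r ∈ (chartAt H p).source) (hq : r ∈ (chartAt H q).source) :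
    ContDiffAt ℝ ∞ (extChartAt I q ∘ (extChartAt I p).symm) (extChartAt I p r) := by
  have := contDiffWithinAt_ext_coord_change (I := I) (n := ∞) q p (y := extChartAt I p r) (by
    rw [PartialEquiv.trans_source'', PartialEquiv.symm_symm, PartialEquiv.symm_target]
    exact Set.mem_image_of_mem _
      ⟨by rwa [extChartAt_source], by rwa [extChartAt_source]⟩)
  rwa [I.range_eq_univ, contDiffWithinAt_univ] at this

end Charts

/-! ### Transformation law of the Christoffel symbols -/

section Transformation

variable {V : Type*} [NormedAddCommGroup V] [NormedSpace ℝ V]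

/-- The transformation law of the Christoffel symbols under a change of coordinates. -/
theorem IsMetricOn.fderiv_christoffelBilin {G G' : V → V →L[ℝ] V →L[ℝ] ℝ} {U U' : Set V}
    (hG : IsMetricOn G U) (hG' : IsMetricOn G' U') {φ : V → V} {y : V} (hy : y ∈ U)
    (hφy : φ y ∈ U') (hφ : ContDiffAt ℝ ∞ φ y) {S : V → V}
    (hS : ∀ a, fderiv ℝ φ y (S a) = a)
    (h : ∀ᶠ z in 𝓝 y, ∀ a b, G z a b = G' (φ z) (fderiv ℝ φ z a) (fderiv ℝ φ z b)) (a b : V) :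
    fderiv ℝ φ y (christoffelBilin G y a b) =
      christoffelBilin G' (φ y) (fderiv ℝ φ y a) (fderiv ℝ φ y b) +
        fderiv ℝ (fderiv ℝ φ) y a b := by
  have hφd : DifferentiableAt ℝ φ y := hφ.differentiableAt (by simp)
  have hdd : DifferentiableAt ℝ (fderiv ℝ φ) y :=
    (hφ.fderiv_right (m := ∞) (by simp)).differentiableAt (by simp)
  have hsymm (a b : V) : fderiv ℝ (fderiv ℝ φ) y a b = fderiv ℝ (fderiv ℝ φ) y b a :=
    hφ.isSymmSndFDerivAt
      (by simp only [minSmoothness_of_isRCLikeNormedField]; exact ENat.LEInfty.out) a b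
  have hG'd := hG'.differentiableAt hφy
  -- The pulled-back connection is torsion-free by the symmetry of D²φ, and compatible because φ is
  -- an isometry; uniqueness identifies it.
  rw [hG.christoffelBilin_eq hy (fun a b ↦ S (christoffelBilin G' (φ y) (fderiv ℝ φ y a)
    (fderiv ℝ φ y b) + fderiv ℝ (fderiv ℝ φ) y a b)), hS]
  · intro a b
    rw [hsymm, hG'.christoffelBilin_symm hφy]
  · intro a b c
    have hD (b : V) : DifferentiableAt ℝ (fun z ↦ fderiv ℝ φ z b) y :=
      hdd.clm_apply (differentiableAt_const b)
    have hD' (b : V) : fderiv ℝ (fun z ↦ fderiv ℝ φ z b) y a = fderiv ℝ (fderiv ℝ φ) y a b := by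
      rw [fderiv_clm_apply hdd (differentiableAt_const b)]; simp
    have hc : DifferentiableAt ℝ (fun z ↦ G' (φ z)) y := hG'd.comp y hφd
    have hc' : fderiv ℝ (fun z ↦ G' (φ z)) y a = fderiv ℝ G' (φ y) (fderiv ℝ φ y a) := by
      have := fderiv_comp y hG'd hφd
      simp only [Function.comp_def] at this
      rw [this]; rfl
    have h1 : (fun z ↦ G z b c) =ᶠ[𝓝 y] fun z ↦ G' (φ z) (fderiv ℝ φ z b) (fderiv ℝ φ z c) := by
      filter_upwards [h] with z hz using hz b c
    rw [← fderiv_apply_apply (hG.differentiableAt hy), h1.fderiv_eq,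
      fderiv_clm_apply_apply hc (hD b) (hD c), hD', hD', hc', hG'.fderiv_eq hφy,
      h.self_of_nhds, h.self_of_nhds, hS, hS]
    simp only [map_add, add_apply]
    ring

end Transformation

/-! ### The Sasaki metric in the charts of the tangent bundle -/

section TangentBundleCharts

variable {E : Type*} [NormedAddCommGroup E] [NormedSpace ℝ E]
  {H : Type*} [TopologicalSpace H] {I : ModelWithCorners ℝ E H}
  {M : Type*} [TopologicalSpace M] [ChartedSpace H M] [IsManifold I ∞ M]

theorem extChartAt_tangent_apply (v w : TangentBundle I M) :
    extChartAt I.tangent v w =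
      (extChartAt I v.proj w.proj, tangentCoordChange I w.proj v.proj w.proj w.snd) := rfl

theorem mem_chartAt_tangent_source (v w : TangentBundle I M) :
    w ∈ (chartAt (ModelProd H E) v).source ↔ w.proj ∈ (chartAt H v.proj).source :=
  TangentBundle.mem_chart_source_iff w v

theorem extChartAt_tangent_target [I.Boundaryless] (v : TangentBundle I M) :
    (extChartAt I.tangent v).target = (extChartAt I v.proj).target ×ˢ Set.univ := by
  ext z
  constructor
  · intro hz
    have h := (extChartAt I.tangent v).map_target hz
    rw [extChartAt_source, mem_chartAt_tangent_source, ← extChartAt_source I] at h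
    refine ⟨?_, trivial⟩
    rw [← (extChartAt I.tangent v).right_inv hz]
    exact (extChartAt I v.proj).map_source h
  · intro hz
    have h := hz.1
    rw [extChartAt_target] at h ⊢
    refine ⟨?_, by rw [I.tangent.range_eq_univ]; trivial⟩
    rw [Set.mem_preimage, TangentBundle.mem_chart_target_iff]
    exact h.1

/-- Changes of coordinates of the tangent bundle are induced by those of the manifold. -/
theorem coordChange_tangent [I.Boundaryless] {v w r : TangentBundle I M}
    (hv : r.proj ∈ (chartAt H v.proj).source) (hw : r.proj ∈ (chartAt H w.proj).source) :
    (extChartAt I.tangent w ∘ (extChartAt I.tangent v).symm) (extChartAt I.tangent v r) =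
      let φ := extChartAt I w.proj ∘ (extChartAt I v.proj).symm
      let z := extChartAt I.tangent v r
      (φ z.1, fderiv ℝ φ z.1 z.2) := by
  have h1 : r ∈ (extChartAt I.tangent v).source := by
    rwa [extChartAt_source, mem_chartAt_tangent_source]
  have h2 : r.proj ∈ (extChartAt I v.proj).source := by rwa [extChartAt_source]
  have h3 : r.proj ∈ (extChartAt I w.proj).source := by rwa [extChartAt_source]
  rw [Function.comp_apply, (extChartAt I.tangent v).left_inv h1]
  simp only [Function.comp_apply, extChartAt_tangent_apply, (extChartAt I v.proj).left_inv h2]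
  refine Prod.ext rfl ?_
  have h4 := fderiv_coordChange (I := I) hv hw
  simp only [h4]
  exact (tangentCoordChange_comp ⟨⟨mem_extChartAt_source _, h2⟩, h3⟩).symm

/-- The differential of the induced coordinate change (x, u) ↦ (φ x, Dφ(x) u). -/
theorem tangentCoordChange_tangent [I.Boundaryless] {v w : TangentBundle I M}
    (hv : w.proj ∈ (chartAt H v.proj).source) (ξ : E × E) :
    let φ := extChartAt I w.proj ∘ (extChartAt I v.proj).symm
    let z := extChartAt I.tangent v w
    tangentCoordChange I.tangent v w w ξ =
      (fderiv ℝ φ z.1 ξ.1, fderiv ℝ (fderiv ℝ φ) z.1 ξ.1 z.2 + fderiv ℝ φ z.1 ξ.2) := by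
  intro φ z
  have hv' := (mem_chartAt_tangent_source v w).2 hv
  have hw := mem_chart_source H w.proj
  rw [← fderiv_coordChange (I := I.tangent) hv' (mem_chart_source _ w)]
  have hφ : ContDiffAt ℝ ∞ φ z.1 := contDiffAt_coordChange (I := I) hv hw
  have hφd : DifferentiableAt ℝ φ z.1 := hφ.differentiableAt (by simp)
  have hdd : DifferentiableAt ℝ (fderiv ℝ φ) z.1 :=
    (hφ.fderiv_right (m := ∞) (by simp)).differentiableAt (by simp)
  have h1 : (extChartAt I.tangent w ∘ (extChartAt I.tangent v).symm) =ᶠ[𝓝 z]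
      fun z ↦ (φ z.1, fderiv ℝ φ z.1 z.2) := by
    have hv2 : w ∈ (extChartAt I.tangent v).source := by rwa [extChartAt_source]
    have hz : z ∈ (extChartAt I.tangent v).target := (extChartAt I.tangent v).map_source hv2
    have hc := continuousAt_extChartAt_symm' hv2
    have hn : (chartAt (ModelProd H E) w).source ∈ 𝓝 ((extChartAt I.tangent v).symm z) := by
      rw [(extChartAt I.tangent v).left_inv hv2]
      exact (chartAt (ModelProd H E) w).open_source.mem_nhds (mem_chart_source _ w)
    filter_upwards [(isOpen_extChartAt_target (I := I.tangent) v).mem_nhds hz,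
      hc.preimage_mem_nhds hn] with z' hz' hw'
    have h1 := (extChartAt I.tangent v).map_target hz'
    rw [extChartAt_source, mem_chartAt_tangent_source] at h1
    have := coordChange_tangent (I := I) h1 ((mem_chartAt_tangent_source w _).1 hw')
    rwa [(extChartAt I.tangent v).right_inv hz'] at this
  rw [h1.fderiv_eq, DifferentiableAt.fderiv_prodMk (differentiableAt_comp_fst hφd)
    ((differentiableAt_comp_fst hdd).clm_apply differentiableAt_snd),
    fderiv_clm_apply (differentiableAt_comp_fst hdd) differentiableAt_snd]
  refine Prod.ext ?_ ?_
  · exact fderiv_comp_fst_apply hφd ξ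
  · simp [fderiv_comp_fst_apply hdd, fderiv_snd, add_comm]

/-- The chart at p is the one that identifies the tangent space at p with E, so its differential
there is the identity. -/
theorem components_apply (p : M) (a : TangentSpace I p) : components I p a = (a : E) := by
  rw [components, mfderiv_extChartAt_self]
  rfl

theorem ofComponents_apply (p : M) (a : E) : ofComponents I p a = (a : TangentSpace I p) :=
  (components_apply p (ofComponents I p a)).symm.trans (components_ofComponents p a)

theorem sasaki_apply_components (g : BilinField I M) (w : TangentBundle I M) (ξ η : E × E) :
    let Γ := christoffelBilin (metricInChart g w.proj) (extChartAt I w.proj w.proj) w.snd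
    sasaki g w ξ η = g w.proj ξ.1 η.1 + g w.proj (ξ.2 + Γ ξ.1) (η.2 + Γ η.1) := by
  intro Γ
  have h1 (ξ : E × E) : @Eq E (horizontalPart w ξ) ξ.1 := by
    refine (components_apply (I := I) w.proj _).symm.trans ((horizontalPart_apply w ξ).trans ?_)
    exact congrArg Prod.fst (components_apply (I := I.tangent) w ξ)
  have h2 (ξ : E × E) : @Eq E (verticalPart g w ξ) (ξ.2 + Γ ξ.1) := by
    have h3 : @Eq (E × E) (components I.tangent w ξ) ξ := components_apply (I := I.tangent) w ξ
    have h4 : @Eq E (components I w.proj w.snd) w.snd := components_apply (I := I) w.proj w.snd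
    refine (ofComponents_apply (I := I) w.proj _).trans ?_
    have h5 (ζ : E × E) (s : E) (hζ : ζ = ξ) (hs : s = w.snd) :
        ζ.2 + christoffelAt g w.proj s ζ.1 = ξ.2 + Γ ξ.1 := by
      rw [hζ, hs]
      exact congrArg (ξ.2 + ·) (DFunLike.congr_fun (christoffelBilin_apply _ _ _).symm ξ.1)
    exact h5 _ _ h3 h4
  have h6 (a b c d a' b' c' d' : E) (ha : a = a') (hb : b = b') (hc : c = c') (hd : d = d') :
      g w.proj a b + g w.proj c d = g w.proj a' b' + g w.proj c' d' := by
    rw [ha, hb, hc, hd]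
  exact h6 _ _ _ _ _ _ _ _ (h1 ξ) (h1 η) (h2 ξ) (h2 η)

/-- Independence of the chart: the left side refers to the chart centred at the base point of w, the
right side to the fixed chart of v. -/
theorem metricInChart_sasaki [I.Boundaryless] [FiniteDimensional ℝ E] {g : BilinField I M}
    (hg : IsPseudoRiemannian I g) {v w : TangentBundle I M}
    (hv : w.proj ∈ (chartAt H v.proj).source) :
    metricInChart (sasaki g) v (extChartAt I.tangent v w) =
      sasakiLocal (metricInChart g v.proj) (extChartAt I.tangent v w) := by
  have hw := mem_chart_source H w.proj
  have hφ : ContDiffAt ℝ ∞ (extChartAt I w.proj ∘ (extChartAt I v.proj).symm)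
    (extChartAt I v.proj w.proj) := contDiffAt_coordChange (I := I) hv hw
  have hD := fderiv_coordChange (I := I) hv hw
  have hv2 : w.proj ∈ (extChartAt I v.proj).source := by rwa [extChartAt_source]
  have hz : extChartAt I v.proj w.proj ∈ (extChartAt I v.proj).target :=
    (extChartAt I v.proj).map_source hv2
  have hφz : (extChartAt I w.proj ∘ (extChartAt I v.proj).symm) (extChartAt I v.proj w.proj) =
      extChartAt I w.proj w.proj := by
    rw [Function.comp_apply, (extChartAt I v.proj).left_inv hv2]
  have hT := tangentCoordChange_tangent (I := I) hv
  have hΓ := IsMetricOn.fderiv_christoffelBilin (hg.isMetricOn_metricInChart v.proj)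
    (hg.isMetricOn_metricInChart w.proj) (y := extChartAt I v.proj w.proj)
    (φ := extChartAt I w.proj ∘ (extChartAt I v.proj).symm) hz
    (by rw [hφz]; exact mem_extChartAt_target _) hφ
    (S := tangentCoordChange I w.proj v.proj w.proj)
    (fun a ↦ by rw [hD]; exact tangentCoordChange_tangentCoordChange hw hv a) (by
      have hc := continuousAt_extChartAt_symm' hv2
      have hn : (chartAt H w.proj).source ∈
          𝓝 ((extChartAt I v.proj).symm (extChartAt I v.proj w.proj)) := by
        rw [(extChartAt I v.proj).left_inv hv2]
        exact (chartAt H w.proj).open_source.mem_nhds hw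
      filter_upwards [(isOpen_extChartAt_target v.proj).mem_nhds hz, hc.preimage_mem_nhds hn]
        with z hz hzw a b
      have h1 := (extChartAt I v.proj).map_target hz
      rw [extChartAt_source] at h1
      have h2 := metricInChart_coordChange g h1 hzw a b
      rwa [← fderiv_coordChange (I := I) h1 hzw, (extChartAt I v.proj).right_inv hz] at h2)
  have hsymm (a b : E) := hφ.isSymmSndFDerivAt
    (by simp only [minSmoothness_of_isRCLikeNormedField]; exact ENat.LEInfty.out) a b
  rw [hφz] at hΓ
  rw [hD] at hΓ
  refine ContinuousLinearMap.ext fun ξ ↦ ContinuousLinearMap.ext fun η ↦ ?_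
  refine (metricInChart_extChartAt (I := I.tangent) (sasaki g)
    ((mem_chartAt_tangent_source v w).2 hv) ξ η).trans ?_
  rw [sasaki_apply_components, sasakiLocal_apply, hT, hT]
  simp only [extChartAt_tangent_apply]
  have hsnd : @Eq E (tangentCoordChange I v.proj w.proj w.proj
      (tangentCoordChange I w.proj v.proj w.proj w.snd)) w.snd :=
    tangentCoordChange_tangentCoordChange (I := I) hw hv w.snd
  -- The vertical part b + Γ(y, a) transforms as a tangent vector: D²φ(y, a) from the law for Γ
  -- equals D²φ(a, y) from the change of coordinates of the tangent bundle.
  have hV (a b y : E) (hy : @Eq E (tangentCoordChange I v.proj w.proj w.proj y) w.snd) :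
      tangentCoordChange I v.proj w.proj w.proj
        (b + christoffelBilin (metricInChart g v.proj) (extChartAt I v.proj w.proj) y a) =
      fderiv ℝ (fderiv ℝ (extChartAt I w.proj ∘ (extChartAt I v.proj).symm))
          (extChartAt I v.proj w.proj) a y + tangentCoordChange I v.proj w.proj w.proj b +
        christoffelBilin (metricInChart g w.proj) (extChartAt I w.proj w.proj) w.snd
          (tangentCoordChange I v.proj w.proj w.proj a) := by
    rw [map_add, hΓ, hy, hsymm y a]
    abel
  rw [metricInChart_extChartAt g hv, metricInChart_extChartAt g hv, hV _ _ _ hsnd, hV _ _ _ hsnd,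
    hD]

end TangentBundleCharts

/-! ### From coordinates to the tangent bundle -/

section Assembly

theorem IsMetricOn.congr {V : Type*} [NormedAddCommGroup V] [NormedSpace ℝ V]
    {G G' : V → V →L[ℝ] V →L[ℝ] ℝ} {U : Set V} (hG : IsMetricOn G U) (h : Set.EqOn G' G U) :
    IsMetricOn G' U where
  isOpen := hG.isOpen
  contDiffOn := hG.contDiffOn.congr h
  symm y hy := by rw [h hy]; exact hG.symm y hy
  isInvertible y hy := by rw [h hy]; exact hG.isInvertible y hy

/-- Curvature depends only on the germ of the metric; openness of U makes all derivatives agree. -/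
theorem IsMetricOn.curvatureLocal_congr {V : Type*} [NormedAddCommGroup V] [NormedSpace ℝ V]
    [CompleteSpace V] {G G' : V → V →L[ℝ] V →L[ℝ] ℝ} {U : Set V} (hG : IsMetricOn G U)
    (h : Set.EqOn G' G U) {y : V} (hy : y ∈ U) (a b c : V) :
    curvatureLocal G' y a b c = curvatureLocal G y a b c := by
  have hΓ : Set.EqOn (christoffelBilin G') (christoffelBilin G) U := fun z hz ↦ by
    have h1 : G' =ᶠ[𝓝 z] G := by filter_upwards [hG.isOpen.mem_nhds hz] with x hx using h hx
    rw [christoffelBilin, christoffelBilin, christoffelFirstTrilin, christoffelFirstTrilin,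
      h1.fderiv_eq, h hz]
  have h2 : christoffelBilin G' =ᶠ[𝓝 y] christoffelBilin G := by
    filter_upwards [hG.isOpen.mem_nhds hy] with x hx using hΓ hx
  rw [(hG.congr h).curvatureLocal_eq hy, hG.curvatureLocal_eq hy, curvatureTrilin_apply,
    curvatureTrilin_apply, h2.fderiv_eq, hΓ hy]

variable {E : Type*} [NormedAddCommGroup E] [NormedSpace ℝ E]
  {H : Type*} [TopologicalSpace H] {I : ModelWithCorners ℝ E H}
  {M : Type*} [TopologicalSpace M] [ChartedSpace H M] [IsManifold I ∞ M]
  {g : BilinField I M}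

theorem IsPseudoRiemannian.eqOn_metricInChart_sasaki [I.Boundaryless] [FiniteDimensional ℝ E]
    (hg : IsPseudoRiemannian I g)
    (v : TangentBundle I M) :
    Set.EqOn (metricInChart (sasaki g) v) (sasakiLocal (metricInChart g v.proj))
      ((extChartAt I v.proj).target ×ˢ (Set.univ : Set E)) := by
  intro z hz
  rw [← extChartAt_tangent_target] at hz
  have h := (extChartAt I.tangent v).map_target hz
  rw [extChartAt_source, mem_chartAt_tangent_source] at h
  have := metricInChart_sasaki hg h
  rwa [(extChartAt I.tangent v).right_inv hz] at this

theorem IsPseudoRiemannian.sasaki [I.Boundaryless] [FiniteDimensional ℝ E]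
    (hg : IsPseudoRiemannian I g) :
    IsPseudoRiemannian I.tangent (sasaki g) :=
  isPseudoRiemannian_of_isMetricOn fun v ↦ by
    rw [extChartAt_tangent_target]
    exact (hg.isMetricOn_metricInChart v.proj).isMetricOn_sasakiLocal.congr
      (hg.eqOn_metricInChart_sasaki v)

theorem curvature_apply (g : BilinField I M) (p : M) (x y z : E) :
    @Eq E (curvature g p x y z) (curvatureLocal (metricInChart g p) (extChartAt I p p) x y z) := by
  refine (ofComponents_apply (I := I) p _).trans ?_
  have h (a a' b b' c c' : E) (ha : a = a') (hb : b = b') (hc : c = c') :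
    curvatureLocal (metricInChart g p) (extChartAt I p p) a b c =
      curvatureLocal (metricInChart g p) (extChartAt I p p) a' b' c' := by rw [ha, hb, hc]
  exact h _ _ _ _ _ _ (components_apply (I := I) p x) (components_apply (I := I) p y)
    (components_apply (I := I) p z)

theorem nablaCurvature_apply (g : BilinField I M) (p : M) (e x y z : E) :
    @Eq E (nablaCurvature g p e x y z)
      (nablaCurvatureLocal (metricInChart g p) (extChartAt I p p) e x y z) := by
  refine (ofComponents_apply (I := I) p _).trans ?_
  have h (a a' b b' c c' d d' : E) (ha : a = a') (hb : b = b') (hc : c = c') (hd : d = d') :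
    nablaCurvatureLocal (metricInChart g p) (extChartAt I p p) d a b c =
      nablaCurvatureLocal (metricInChart g p) (extChartAt I p p) d' a' b' c' := by
    rw [ha, hb, hc, hd]
  exact h _ _ _ _ _ _ _ _ (components_apply (I := I) p x) (components_apply (I := I) p y)
    (components_apply (I := I) p z) (components_apply (I := I) p e)

/-- In its own chart, the fibre coordinate of v is the vector itself. -/
theorem extChartAt_tangent_self (v : TangentBundle I M) :
    extChartAt I.tangent v v = (extChartAt I v.proj v.proj, (v.snd : E)) :=
  Prod.ext rfl (tangentCoordChange_self (I := I) (mem_extChartAt_source v.proj))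

theorem horizontalLift_eq (g : BilinField I M) (X : ∀ p : M, TangentSpace I p)
    (v : TangentBundle I M) :
    @Eq (E × E) (horizontalLift g X v)
      (horizontalLocal (christoffelBilin (metricInChart g v.proj))
        (extChartAt I v.proj v.proj, v.snd) (X v.proj)) := by
  refine (ofComponents_apply (I := I.tangent) v _).trans ?_
  have h (a b s t : E) (ha : a = b) (hs : s = t) :
      (a, -christoffelAt g v.proj s a) = horizontalLocal (christoffelBilin (metricInChart g v.proj))
        (extChartAt I v.proj v.proj, t) b := by
    rw [ha, hs]
    exact congrArg (fun c : E ↦ (b, -c))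
      (DFunLike.congr_fun (christoffelBilin_apply _ _ _).symm b)
  exact h _ _ _ _ (components_apply (I := I) v.proj (X v.proj))
    (components_apply (I := I) v.proj v.snd)

theorem verticalLift_eq (X : ∀ p : M, TangentSpace I p) (v : TangentBundle I M) :
    @Eq (E × E) (verticalLift X v) (0, X v.proj) :=
  (ofComponents_apply (I := I.tangent) v _).trans
    (congrArg (Prod.mk (0 : E)) (components_apply (I := I) v.proj (X v.proj)))

theorem IsPseudoRiemannian.curvature4_sasaki [I.Boundaryless] [FiniteDimensional ℝ E]
    (hg : IsPseudoRiemannian I g)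
    (v : TangentBundle I M) (ξ η ζ θ : E × E) :
    let G := metricInChart g v.proj
    let z : E × E := (extChartAt I v.proj v.proj, v.snd)
    curvature4 (SasakiMetric.sasaki g) v ξ η ζ θ =
      sasakiLocal G z (curvatureLocal (sasakiLocal G) z ξ η ζ) θ := by
  intro G z
  have hz : z ∈ (extChartAt I v.proj).target ×ˢ (Set.univ : Set E) :=
    ⟨mem_extChartAt_target v.proj, trivial⟩
  have h1 := hg.eqOn_metricInChart_sasaki v
  have : CompleteSpace E := FiniteDimensional.complete ℝ E
  have h2 := (hg.isMetricOn_metricInChart v.proj).isMetricOn_sasakiLocal.curvatureLocal_congr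
    h1 hz ξ η ζ
  rw [← h2, ← h1 hz]
  have hzv : z = extChartAt I.tangent v v := (extChartAt_tangent_self v).symm
  rw [hzv, metricInChart_self]
  exact congrArg (fun a : E × E ↦ SasakiMetric.sasaki g v a θ)
    (curvature_apply (I := I.tangent) (SasakiMetric.sasaki g) v ξ η ζ)

end Assembly

end

end SasakiMetric

open SasakiMetric in
theorem mainTheorem8 {E : Type*} [NormedAddCommGroup E] [NormedSpace ℝ E] [FiniteDimensional ℝ E]
    {M : Type*} [TopologicalSpace M] [ChartedSpace E M] [IsManifold 𝓘(ℝ, E) ∞ M]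
    (g : BilinField 𝓘(ℝ, E) M) (hg : IsPseudoRiemannian 𝓘(ℝ, E) g) :
    IsPseudoRiemannian 𝓘(ℝ, E).tangent (sasaki g) ∧
    ∀ (X Y Z W : ∀ p : M, TangentSpace 𝓘(ℝ, E) p) (p : M) (u : TangentSpace 𝓘(ℝ, E) p),
      let R := curvature g p
      let R4 := curvature4 g p
      let DR := nablaCurvature g p
      let x := X p
      let y := Y p
      let z := Z p
      let w := W p
      let v : TangentBundle 𝓘(ℝ, E) M := ⟨p, u⟩
      let Rhat := curvature4 (sasaki g) v
      let XH := horizontalLift g X v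
      let YH := horizontalLift g Y v
      let ZH := horizontalLift g Z v
      let WH := horizontalLift g W v
      let XV := verticalLift X v
      let YV := verticalLift Y v
      let ZV := verticalLift Z v
      let WV := verticalLift W v
      Rhat XH YH ZH WH = R4 x y z w
          + 1 / 4 * (g p (R w x u) (R y z u) - g p (R w y u) (R x z u))
          + 1 / 2 * g p (R x y u) (R z w u) ∧
      Rhat XH YH ZH WV = -(1 / 2) * g p (DR x y z u - DR y x z u) w ∧
      Rhat XH YH ZV WV = R4 x y z w
          - 1 / 4 * (g p (R u w x) (R u z y) - g p (R u w y) (R u z x)) ∧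
      Rhat XH YV ZH WH = 1 / 2 * g p (DR x u y z) w ∧
      Rhat XH YV ZH WV = 1 / 2 * R4 x z y w - 1 / 4 * g p (R u y z) (R u w x) ∧
      Rhat XV YV ZH WH = R4 x y z w
          - 1 / 4 * (g p (R u y z) (R u x w) - g p (R u x z) (R u y w)) ∧
      Rhat XV YV ZH WV = 0 ∧
      Rhat XH YV ZV WV = 0 ∧
      Rhat XV YV ZV WV = 0 := by
  refine ⟨hg.sasaki, fun X Y Z W p u ↦ ?_⟩
  intro R R4 DR x y z w v Rhat XH YH ZH WH XV YV ZV WV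
  have hR : @Eq (E → E → E → E) R (curvatureLocal (metricInChart g p) (extChartAt 𝓘(ℝ, E) p p)) :=
    funext fun a ↦ funext fun b ↦ funext fun c ↦ curvature_apply g p a b c
  have hD : @Eq (E → E → E → E → E) DR
      (nablaCurvatureLocal (metricInChart g p) (extChartAt 𝓘(ℝ, E) p p)) :=
    funext fun e ↦ funext fun a ↦ funext fun b ↦ funext fun c ↦ nablaCurvature_apply g p e a b c
  have key := (hg.isMetricOn_metricInChart p).sasakiLocal_curvatureLocal
    (mem_extChartAt_target p) u x y z w
  -- At the centre of its chart the coordinate metric is g itself, so the coordinate identities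
  -- become the intrinsic ones.
  have hm : @Eq (E →L[ℝ] E →L[ℝ] ℝ) (metricInChart g p (extChartAt 𝓘(ℝ, E) p p)) (g p) :=
    ContinuousLinearMap.ext fun a ↦ ContinuousLinearMap.ext fun b ↦ metricInChart_self g p a b
  rw [← hR, ← hD, hm] at key
  -- The lifts agree with their coordinate forms as elements of E × E; `hC` substitutes them into
  -- the curvature of ĝ.
  have hC (ξ η ζ θ ξ' η' ζ' θ' : E × E) (h1 : ξ = ξ') (h2 : η = η') (h3 : ζ = ζ') (h4 : θ = θ') :
      curvature4 (sasaki g) v ξ η ζ θ = sasakiLocal (metricInChart g p)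
        (extChartAt 𝓘(ℝ, E) p p, u) (curvatureLocal (sasakiLocal (metricInChart g p))
          (extChartAt 𝓘(ℝ, E) p p, u) ξ' η' ζ') θ' := by
    subst h1 h2 h3 h4
    exact hg.curvature4_sasaki v ξ η ζ θ
  have hX := horizontalLift_eq g X v
  have hY := horizontalLift_eq g Y v
  have hZ := horizontalLift_eq g Z v
  have hW := horizontalLift_eq g W v
  have vX := verticalLift_eq X v
  have vY := verticalLift_eq Y v
  have vZ := verticalLift_eq Z v
  have vW := verticalLift_eq W v
  obtain ⟨k1, k2, k3, k4, k5, k6, k7, k8, k9⟩ := key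
  exact ⟨(hC _ _ _ _ _ _ _ _ hX hY hZ hW).trans k1, (hC _ _ _ _ _ _ _ _ hX hY hZ vW).trans k2,
    (hC _ _ _ _ _ _ _ _ hX hY vZ vW).trans k3, (hC _ _ _ _ _ _ _ _ hX vY hZ hW).trans k4,
    (hC _ _ _ _ _ _ _ _ hX vY hZ vW).trans k5, (hC _ _ _ _ _ _ _ _ vX vY hZ hW).trans k6,
    (hC _ _ _ _ _ _ _ _ vX vY hZ vW).trans k7, (hC _ _ _ _ _ _ _ _ hX vY vZ vW).trans k8,
    (hC _ _ _ _ _ _ _ _ vX vY vZ vW).trans k9⟩
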